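/- Let $v:\mathbb R\to\mathbb R$ be a smooth ($C^\infty$) $1$-periodic function with $\max_{\mathbb R}v=0$, and let $\mu\in\mathbb R$ satisfy $|\mu|<\int_0^1\sqrt{(1-v(y))^2-1}\,dy$. Put $\mathcal M_0=\{x\in[0,1): v(x)=0\}$ and assume that $\mathcal M_0$ is finite and that the values $v''(x)$, $x\in\mathcal M_0$, are pairwise distinct. Then: 1. For every $d>0$ there is exactly one pair $(\overline H_d,w_d)$ of a real number $\overline H_d$ and a $1$-periodic function $w_d\in C^2(\mathbb R)$ with $w_d(0)=0$ such that $$-\frac{d\,w_d''}{1+(\mu+w_d')^2}+\sqrt{1+(\mu+w_d')^2}+v(y)=\overline H_d\quad\text{in }\mathbb R .$$ 2. There is a unique $\bar x\in\mathcal M_0$ with $|v''(\bar x)|=\min_{x\in\mathcal M_0}|v''(x)|$, and a unique $x_\mu\in(\bar x,\bar x+1)$ with $$\int_{\bar x}^{x_\mu}\sqrt{(1-v)^2-1}\,dy-\int_{x_\mu}^{\bar x+1}\sqrt{(1-v)^2-1}\,dy=\mu .$$ 3. Let $w_0$ be the $1$-periodic function given on $[\bar x,\bar x+1]$ by $$w_0(x)=\begin{cases}\displaystyle\int_{\bar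 x}^{x}\sqrt{(1-v)^2-1}\,dy-\mu x, & x\in[\bar x,x_\mu],\\[2mm] \displaystyle\int_{\bar x}^{x_\mu}\sqrt{(1-v)^2-1}\,dy-\int_{x_\mu}^{x}\sqrt{(1-v)^2-1}\,dy-\mu x, & x\in[x_\mu,\bar x+1].\end{cases}$$ Then $w_0$ is a viscosity solution of $\sqrt{1+(\mu+w_0')^2}+v=1$ in $\mathbb R$, and $$\lim_{d\to0^+}w_d(x)=w_0(x)-w_0(0)\quad\text{uniformly in }x\in\mathbb R .$$ -/

import Mathlib

open Set Filter Topology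

noncomputable section

namespace GEquation

/-- `w` is a `C²`, `1`-periodic solution, normalized by `w 0 = 0`, of the cell problem
`-d w'' / (1 + (μ + w')²) + √(1 + (μ + w')²) + v = H` on `ℝ`
(shear flow with profile `v`, direction `p = (1, μ)`, Markstein number `d`). -/
structure IsCellSolution (v : ℝ → ℝ) (μ d H : ℝ) (w : ℝ → ℝ) : Prop where
  contDiff : ContDiff ℝ 2 w
  periodic : Function.Periodic w 1
  normalized : w 0 = 0
  equation : ∀ y : ℝ,
    -(d * deriv (deriv w) y / (1 + (μ + deriv w y) ^ 2))
      + √(1 + (μ + deriv w y) ^ 2) + v y = H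

/-- `w` is a (continuous) viscosity solution on `ℝ` of the inviscid equation
`√(1 + (μ + w')²) + v = H`: subsolution and supersolution tests with `C¹` functions
touching from above and from below. -/
structure IsInviscidViscositySolution (v : ℝ → ℝ) (μ H : ℝ) (w : ℝ → ℝ) : Prop where
  continuous : Continuous w
  subsolution : ∀ (φ : ℝ → ℝ) (y : ℝ), ContDiff ℝ 1 φ →
    IsLocalMax (fun x => w x - φ x) y → √(1 + (μ + deriv φ y) ^ 2) + v y ≤ H
  supersolution : ∀ (φ : ℝ → ℝ) (y : ℝ), ContDiff ℝ 1 φ →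
    IsLocalMin (fun x => w x - φ x) y → H ≤ √(1 + (μ + deriv φ y) ^ 2) + v y

/-- The maximum points of `v` in the period cell `[0, 1)`. -/
def maxPoints (v : ℝ → ℝ) : Set ℝ :=
  {x | x ∈ Ico (0 : ℝ) 1 ∧ ∀ y : ℝ, v y ≤ v x}

/-- The inviscid slope `√((1 - v)² - 1)`. -/
def slope (v : ℝ → ℝ) (y : ℝ) : ℝ := √((1 - v y) ^ 2 - 1)

/-- The balance condition that determines the point `z = x_μ`:
the slope integrates over `[a, z]` and over `[z, a + 1]` to quantities with difference `μ`. -/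
def IsBalanced (v : ℝ → ℝ) (μ a z : ℝ) : Prop :=
  (∫ y in a..z, slope v y) - (∫ y in z..(a + 1), slope v y) = μ

/-- The piecewise formula on the cell `[a, a + 1]`. -/
def cellProfile (v : ℝ → ℝ) (μ a z x : ℝ) : ℝ :=
  if x ≤ z then (∫ y in a..x, slope v y) - μ * x
  else (∫ y in a..z, slope v y) - (∫ y in z..x, slope v y) - μ * x

/-- The `1`-periodic function that equals `cellProfile v μ a z` on `[a, a + 1)`. -/
def physicalSolution (v : ℝ → ℝ) (μ a z x : ℝ) : ℝ :=
  cellProfile v μ a z (toIcoMod (zero_lt_one' ℝ) a x)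

end GEquation

end

namespace GEquation

/-! Put `u = μ + w'`. The cell problem becomes `d u' = (1 + u²)(√(1 + u²) + v - H)` with `u`
periodic of mean `μ` (`IsProfile`). A periodic function cannot cross a level in one direction only.
Hence profiles with different `H` never meet, which gives uniqueness, and a shooting argument gives
existence (`exists_isProfile`).

Multiplying the equation by the residual `√(1 + u²) + v - H` and integrating over a period bounds
its square in mean by `O(d)` (`IsProfile.integral_sq_le`). Therefore `H → 1` and `|u| → √((1 - v)² -
1)` in `L¹` (`eventually_integral_abs_sub_le`). What remains is the sign of `u`. In the limit it can
change from minus to plus only at a zero of `v`, and the first order correction to `H` decides at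
which one. For every maximum point `a`, `1 - H ≤ d√|v''(a)| + o(d)` (`eventually_one_sub_level_le`);
the strongest of these bounds comes from the flattest maximum. At the other maxima an upward
crossing would need a larger `1 - H`: a barrier of slope `κ` with `√|v''(a)| < κ < √|v''(e)|` can
only be crossed downwards (`exists_barrier`, `eventually_deriv_lt_barrier`).

So on the cell starting at the flattest maximum, `u` is close to the positive branch up to one point
and to the negative branch after it; the mean `μ` fixes the balance in the limit
(`eventually_abs_integral_sub_le`). The primitive of the limit is the smaller of two branches, which
yields the viscosity property. -/

/-! ### One-directional crossings and periodic functions. -/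

lemma nonpos_of_deriv_neg_of_eq_zero {f f' : ℝ → ℝ} {a b : ℝ}
    (hf : ∀ x ∈ Icc a b, HasDerivWithinAt f (f' x) (Icc a b) x)
    (hneg : ∀ x ∈ Icc a b, f x = 0 → f' x < 0) (ha : f a ≤ 0) :
    ∀ x ∈ Icc a b, f x ≤ 0 := by
  intro x hx
  refine image_le_of_deriv_right_lt_deriv_boundary' (f := f) (f' := f') (a := a) (b := b)
    (B := fun _ => 0) (B' := fun _ => 0)
    (fun x hx => (hf x hx).continuousWithinAt)
    (fun x hx => (hf x (Ico_subset_Icc_self hx)).mono_of_mem_nhdsWithin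
      (Icc_mem_nhdsGE_of_mem hx)) ha continuousOn_const
    (fun x _ => hasDerivWithinAt_const _ _ _)
    (fun x hx h => hneg x (Ico_subset_Icc_self hx) h) hx

lemma nonneg_of_deriv_pos_of_eq_zero {f f' : ℝ → ℝ} {a b : ℝ}
    (hf : ∀ x ∈ Icc a b, HasDerivWithinAt f (f' x) (Icc a b) x)
    (hpos : ∀ x ∈ Icc a b, f x = 0 → 0 < f' x) (ha : 0 ≤ f a) :
    ∀ x ∈ Icc a b, 0 ≤ f x := by
  intro x hx
  have := nonpos_of_deriv_neg_of_eq_zero (f := fun x => - f x) (f' := fun x => - f' x)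
    (fun x hx => (hf x hx).neg) (fun x hx h => by have := hpos x hx (by linarith); linarith)
    (by linarith) x hx
  linarith

/-- A periodic function cannot cross zero in only one direction. -/
lemma ne_zero_of_periodic_of_deriv_neg {f f' : ℝ → ℝ} (hper : Function.Periodic f 1)
    (hf : ∀ x, HasDerivAt f (f' x) x) (hneg : ∀ x, f x = 0 → f' x < 0) (x : ℝ) : f x ≠ 0 := by
  intro h0
  have h1 : f (x + 1) = 0 := by rw [hper x, h0]
  have h2 := nonpos_of_deriv_neg_of_eq_zero (a := x) (b := x + 1) (fun x _ => (hf x).hasDerivWithinAt)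
    (fun x _ => hneg x) h0.le
  -- The period brings `f` back to zero at `x + 1`, which is thus a maximum on the interval; moving
  -- left from it gives `0 ≤ f' (x + 1)`.
  have h3 : IsLocalMaxOn f (Icc x (x + 1)) (x + 1) :=
    Filter.eventually_of_mem self_mem_nhdsWithin (fun y hy => by rw [h1]; exact h2 y hy)
  have h4 : (-1 : ℝ) ∈ posTangentConeAt (Icc x (x + 1)) (x + 1) := by
    apply mem_posTangentConeAt_of_segment_subset
    rw [segment_symm, segment_eq_Icc (by linarith)]
    apply Icc_subset_Icc <;> linarith
  have h5 := h3.hasFDerivWithinAt_nonpos (hf (x + 1)).hasFDerivAt.hasFDerivWithinAt h4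
  have h6 := hneg _ h1
  simp at h5
  linarith

lemma ne_zero_of_periodic_of_deriv_pos {f f' : ℝ → ℝ} (hper : Function.Periodic f 1)
    (hf : ∀ x, HasDerivAt f (f' x) x) (hpos : ∀ x, f x = 0 → 0 < f' x) (x : ℝ) : f x ≠ 0 := by
  have := ne_zero_of_periodic_of_deriv_neg (f := fun x => - f x) (f' := fun x => - f' x)
    (fun x => by simp [hper x]) (fun x => (hf x).neg)
    (fun x h => by have := hpos x (by linarith); linarith) x
  intro h
  exact this (by simp [h])

lemma pos_or_neg_of_ne_zero {f : ℝ → ℝ} (hf : Continuous f) (h0 : ∀ x, f x ≠ 0) :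
    (∀ x, 0 < f x) ∨ ∀ x, f x < 0 := by
  by_contra! h
  obtain ⟨⟨a, ha⟩, b, hb⟩ := h
  obtain ⟨c, hc⟩ := mem_range_of_exists_le_of_exists_ge hf ⟨a, ha⟩ ⟨b, hb⟩
  exact h0 c hc

lemma exists_eq_zero_of_integral_eq_zero {f : ℝ → ℝ} (hf : Continuous f)
    (h : ∫ x in (0:ℝ)..1, f x = 0) : ∃ x, f x = 0 := by
  by_contra! h0
  rcases pos_or_neg_of_ne_zero hf h0 with h1 | h1
  · have := intervalIntegral.intervalIntegral_pos_of_pos (hf.intervalIntegrable 0 1) h1 one_pos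
    linarith
  · have := intervalIntegral.intervalIntegral_pos_of_pos (f := fun x => - f x)
      (hf.neg.intervalIntegrable 0 1) (fun x => by have := h1 x; linarith) one_pos
    rw [intervalIntegral.integral_neg] at this
    linarith

lemma exists_forall_le_of_periodic {f : ℝ → ℝ} (hf : Continuous f) (hper : Function.Periodic f 1) :
    ∃ x, ∀ y, f y ≤ f x := by
  obtain ⟨x, -, hx⟩ := isCompact_Icc.exists_isMaxOn (s := Icc (0:ℝ) 1) ⟨0, by simp⟩ hf.continuousOn
  refine ⟨x, fun y => ?_⟩
  obtain ⟨z, hz, hyz⟩ := hper.exists_mem_Ico₀ one_pos y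
  rw [hyz]
  exact hx (Ico_subset_Icc_self hz)

lemma exists_forall_ge_of_periodic {f : ℝ → ℝ} (hf : Continuous f) (hper : Function.Periodic f 1) :
    ∃ x, ∀ y, f x ≤ f y := by
  obtain ⟨x, hx⟩ := exists_forall_le_of_periodic hf.neg (fun x => by simp [hper x])
  exact ⟨x, fun y => by simpa using hx y⟩

/-! ### The first order formulation. -/

/-- The `1`-periodic slope `u = μ + w'` of a cell solution: a first order formulation. -/
structure IsProfile (v : ℝ → ℝ) (μ d H : ℝ) (u : ℝ → ℝ) : Prop where
  periodic : Function.Periodic u 1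
  hasDerivAt : ∀ x, HasDerivAt u ((1 + u x ^ 2) * (√(1 + u x ^ 2) + v x - H) / d) x
  mean : ∫ x in (0:ℝ)..1, u x = μ

lemma IsProfile.continuous {v : ℝ → ℝ} {μ d H : ℝ} {u : ℝ → ℝ} (hu : IsProfile v μ d H u) :
    Continuous u :=
  continuous_iff_continuousAt.2 fun x => (hu.hasDerivAt x).continuousAt

lemma IsCellSolution.hasDerivAt {v : ℝ → ℝ} {μ d H : ℝ} {w : ℝ → ℝ}
    (hw : IsCellSolution v μ d H w) (x : ℝ) : HasDerivAt w (deriv w x) x :=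
  ((hw.contDiff.differentiable (by norm_num)) x).hasDerivAt

lemma IsCellSolution.continuous_deriv {v : ℝ → ℝ} {μ d H : ℝ} {w : ℝ → ℝ}
    (hw : IsCellSolution v μ d H w) : Continuous (deriv w) :=
  hw.contDiff.continuous_deriv (by norm_num)

lemma IsCellSolution.isProfile {v : ℝ → ℝ} {μ d H : ℝ} {w : ℝ → ℝ} (hd : 0 < d)
    (hw : IsCellSolution v μ d H w) : IsProfile v μ d H (fun x => μ + deriv w x) where
  periodic x := by
    have : deriv w (x + 1) = deriv w x := by
      rw [← deriv_comp_add_const, funext hw.periodic]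
    simp [this]
  hasDerivAt x := by
    have h1 : Differentiable ℝ (deriv w) :=
      (hw.contDiff.differentiable_deriv_two)
    have h2 := (h1 x).hasDerivAt.const_add μ
    refine h2.congr_deriv ?_
    have h3 := hw.equation x
    have h4 : (0:ℝ) < 1 + (μ + deriv w x) ^ 2 := by positivity
    rw [← h3]
    field_simp
    ring
  mean := by
    have h1 : ∫ x in (0:ℝ)..1, deriv w x = 0 := by
      rw [intervalIntegral.integral_deriv_eq_sub' w rfl
        (fun x _ => (hw.hasDerivAt x).differentiableAt) hw.continuous_deriv.continuousOn]
      have := hw.periodic 0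
      simp only [zero_add] at this
      rw [this, sub_self]
    rw [intervalIntegral.integral_add (by simp) (hw.continuous_deriv.intervalIntegrable _ _), h1]
    simp

lemma IsProfile.isCellSolution {v : ℝ → ℝ} {μ d H : ℝ} {u : ℝ → ℝ} (hd : 0 < d)
    (hv : Continuous v) (hu : IsProfile v μ d H u) :
    IsCellSolution v μ d H (fun x => ∫ y in (0:ℝ)..x, (u y - μ)) := by
  have hc : Continuous (fun y => u y - μ) := hu.continuous.sub continuous_const
  have h1 : ∀ x, HasDerivAt (fun x => ∫ y in (0:ℝ)..x, (u y - μ)) (u x - μ) x := fun x =>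
    intervalIntegral.integral_hasDerivAt_right (hc.intervalIntegrable _ _)
      hc.stronglyMeasurable.stronglyMeasurableAtFilter hc.continuousAt
  have h2 : deriv (fun x => ∫ y in (0:ℝ)..x, (u y - μ)) = fun x => u x - μ :=
    funext fun x => (h1 x).deriv
  have h3 : deriv (fun x => u x - μ) = fun x => (1 + u x ^ 2) * (√(1 + u x ^ 2) + v x - H) / d :=
    funext fun x => ((hu.hasDerivAt x).sub_const μ).deriv
  refine ⟨?_, ?_, by simp, ?_⟩
  · rw [show (2 : WithTop ℕ∞) = 1 + 1 by norm_num, contDiff_succ_iff_deriv]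
    refine ⟨fun x => (h1 x).differentiableAt, by simp, ?_⟩
    rw [h2, contDiff_one_iff_deriv]
    refine ⟨fun x => ((hu.hasDerivAt x).sub_const μ).differentiableAt, ?_⟩
    rw [h3]
    have := hu.continuous
    fun_prop
  · intro x
    have hp : Function.Periodic (fun y => u y - μ) 1 := fun x => by simp [hu.periodic x]
    have h4 := hp.intervalIntegral_add_eq x 0
    rw [zero_add, intervalIntegral.integral_sub (hu.continuous.intervalIntegrable _ _) (by simp),
      intervalIntegral.integral_sub (hu.continuous.intervalIntegrable _ _) (by simp), hu.mean] at h4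
    rw [← intervalIntegral.integral_sub (hu.continuous.intervalIntegrable _ _) (by simp)] at h4
    simp only
    rw [← intervalIntegral.integral_add_adjacent_intervals (hc.intervalIntegrable 0 x)
      (hc.intervalIntegrable x (x + 1)), h4]
    simp
  · intro y
    rw [h2, h3]
    simp only [add_sub_cancel]
    have h4 : (0:ℝ) < 1 + u y ^ 2 := by positivity
    field_simp
    ring

lemma sqrt_one_add_sq_le_iff {a b : ℝ} : √(1 + a ^ 2) ≤ √(1 + b ^ 2) ↔ |a| ≤ |b| := by
  rw [Real.sqrt_le_sqrt_iff (by positivity), add_le_add_iff_left, sq_le_sq]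

lemma abs_le_sqrt_one_add_sq (a : ℝ) : |a| ≤ √(1 + a ^ 2) :=
  Real.abs_le_sqrt (by linarith)

lemma one_le_sqrt_one_add_sq (a : ℝ) : 1 ≤ √(1 + a ^ 2) :=
  Real.one_le_sqrt.2 (by nlinarith [sq_nonneg a])

lemma exists_lipschitzOnWith_of_contDiff {E F : Type*} [NormedAddCommGroup E] [NormedSpace ℝ E]
    [NormedAddCommGroup F] [NormedSpace ℝ F] {f : E → F} {s : Set E}
    (hs : IsCompact s) (hf : ContDiff ℝ 1 f) : ∃ K, LipschitzOnWith K f s :=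
  LocallyLipschitzOn.exists_lipschitzOnWith_of_compact hs
    ((hf.locallyLipschitz).locallyLipschitzOn)

/-- The value of `v` and the level are separate variables, so one Lipschitz constant on a compact
box serves all times even when `v` is merely continuous. -/
lemma contDiff_rhs : ContDiff ℝ 1
    (fun p : ℝ × ℝ × ℝ => (1 + p.1 ^ 2) * (√(1 + p.1 ^ 2) + p.2.1 - p.2.2)) := by
  have h : ContDiff ℝ 1 (fun p : ℝ × ℝ × ℝ => √(1 + p.1 ^ 2)) :=
    ContDiff.sqrt (by fun_prop) (fun p => by positivity)
  fun_prop

/-! ### Uniqueness, a priori bounds and the energy identity for profiles. -/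

section
variable {v : ℝ → ℝ} {μ d H : ℝ} {u : ℝ → ℝ}

lemma IsProfile.exists_eq_mean (hu : IsProfile v μ d H u) : ∃ x, u x = μ := by
  obtain ⟨x, hx⟩ := exists_eq_zero_of_integral_eq_zero (f := fun x => u x - μ)
    (hu.continuous.sub continuous_const) (by
      rw [intervalIntegral.integral_sub (hu.continuous.intervalIntegrable _ _) (by simp), hu.mean]
      simp)
  exact ⟨x, by linarith⟩

/-- Profiles with different levels cannot meet. -/
lemma IsProfile.level_le_of_eq {μ' H' : ℝ} {u' : ℝ → ℝ} (hd : 0 < d) (hu : IsProfile v μ d H u)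
    (hu' : IsProfile v μ' d H' u') {x : ℝ} (hx : u x = u' x) : H' ≤ H := by
  by_contra! hlt
  refine ne_zero_of_periodic_of_deriv_pos (f := fun x => u x - u' x)
    (fun x => by simp [hu.periodic x, hu'.periodic x])
    (fun x => (hu.hasDerivAt x).sub (hu'.hasDerivAt x)) (fun x hx => ?_) x (sub_eq_zero.2 hx)
  have h1 : u x = u' x := by linarith
  rw [h1, ← sub_div, ← mul_sub]
  have : 0 < H' - H := by linarith
  have : √(1 + u' x ^ 2) + v x - H - (√(1 + u' x ^ 2) + v x - H') = H' - H := by ring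
  rw [this]
  positivity

/-- Equal means force the two profiles to meet, and meeting forces equal levels. Both are bounded,
so the equation is Lipschitz on their common range and Cauchy–Lipschitz applies. -/
lemma IsProfile.unique {H' : ℝ} {u' : ℝ → ℝ} (hd : 0 < d) (hv : Continuous v)
    (hper : Function.Periodic v 1) (hu : IsProfile v μ d H u)
    (hu' : IsProfile v μ d H' u') : H = H' ∧ u = u' := by
  obtain ⟨x, hx⟩ := exists_eq_zero_of_integral_eq_zero (f := fun x => u x - u' x)
    (hu.continuous.sub hu'.continuous) (by
      rw [intervalIntegral.integral_sub (hu.continuous.intervalIntegrable _ _)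
        (hu'.continuous.intervalIntegrable _ _), hu.mean, hu'.mean, sub_self])
  have hH : H = H' := le_antisymm (hu'.level_le_of_eq hd hu (by linarith : u' x = u x))
    (hu.level_le_of_eq hd hu' (by linarith : u x = u' x))
  subst hH
  refine ⟨rfl, ?_⟩
  obtain ⟨a, ha⟩ := exists_forall_le_of_periodic (f := fun x => |u x|) hu.continuous.abs
    (fun x => by simp [hu.periodic x])
  obtain ⟨b, hb⟩ := exists_forall_le_of_periodic (f := fun x => |u' x|) hu'.continuous.abs
    (fun x => by simp [hu'.periodic x])
  obtain ⟨c, hc⟩ := exists_forall_le_of_periodic (f := fun x => |v x|) hv.abs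
    (fun x => by simp [hper x])
  set R := max |u a| |u' b| with hR
  obtain ⟨K, hK⟩ := exists_lipschitzOnWith_of_contDiff
    (s := Icc (-R) R ×ˢ Icc (-|v c|) (|v c|) ×ˢ {H})
    (isCompact_Icc.prod (isCompact_Icc.prod isCompact_singleton)) (contDiff_rhs.div_const d)
  refine ODE_solution_unique_univ (t₀ := x) (K := K) (s := fun _ => Icc (-R) R)
    (v := fun t y => (1 + y ^ 2) * (√(1 + y ^ 2) + v t - H) / d) (fun t => ?_)
    (fun t => ⟨hu.hasDerivAt t, ?_⟩) (fun t => ⟨hu'.hasDerivAt t, ?_⟩) (by linarith)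
  · intro y hy z hz
    have := hK (x := (y, v t, H)) ⟨hy, abs_le.1 (hc t), rfl⟩ (y := (z, v t, H))
      ⟨hz, abs_le.1 (hc t), rfl⟩
    simpa [Prod.edist_eq] using this
  · exact abs_le.1 ((ha t).trans (le_max_left _ _))
  · exact abs_le.1 ((hb t).trans (le_max_right _ _))

/-- `H ≤ √(1 + μ²) + max v`. -/
lemma IsProfile.level_le_sqrt (hd : 0 < d) (hv0 : ∀ x, v x ≤ 0)
    (hu : IsProfile v μ d H u) : H ≤ √(1 + μ ^ 2) := by
  by_contra! hlt
  obtain ⟨x, hx⟩ := hu.exists_eq_mean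
  refine ne_zero_of_periodic_of_deriv_neg (f := fun x => u x - μ)
    (fun x => by simp [hu.periodic x])
    (fun x => (hu.hasDerivAt x).sub_const μ) (fun x hx => ?_) x (by linarith)
  have h1 : u x = μ := by linarith
  rw [h1]
  have := hv0 x
  apply div_neg_of_neg_of_pos _ hd
  apply mul_neg_of_pos_of_neg (by positivity) (by linarith)

/-- Where `u'` vanishes so does the residual. Evaluated at the maximum and minimum of `u`, this
gives pointwise bounds independent of `d`. -/
lemma IsProfile.sqrt_eq_of_isLocalExtr (hd : 0 < d) (hu : IsProfile v μ d H u) {x : ℝ}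
    (hx : IsLocalExtr u x) : √(1 + u x ^ 2) = H - v x := by
  have h := hx.hasDerivAt_eq_zero (hu.hasDerivAt x)
  have h1 : (0:ℝ) < 1 + u x ^ 2 := by positivity
  rw [div_eq_zero_iff, mul_eq_zero] at h
  rcases h with (h | h) | h <;> linarith

lemma IsProfile.abs_apply_le (hd : 0 < d) (hu : IsProfile v μ d H u) {V : ℝ}
    (hV : ∀ x, -V ≤ v x) (x : ℝ) : |u x| ≤ H + V := by
  obtain ⟨a, ha⟩ := exists_forall_le_of_periodic hu.continuous hu.periodic
  obtain ⟨b, hb⟩ := exists_forall_ge_of_periodic hu.continuous hu.periodic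
  have h1 := hu.sqrt_eq_of_isLocalExtr hd (x := a) (Or.inr (Eventually.of_forall ha))
  have h2 := hu.sqrt_eq_of_isLocalExtr hd (x := b) (Or.inl (Eventually.of_forall hb))
  have h3 := abs_le_sqrt_one_add_sq (u a)
  have h4 := abs_le_sqrt_one_add_sq (u b)
  have := hV a
  have := hV b
  have := neg_abs_le (u b)
  have := le_abs_self (u a)
  rw [abs_le]
  constructor <;> linarith [ha x, hb x]

/-- Above the critical level the profile has a constant sign. -/
lemma IsProfile.ne_zero (hd : 0 < d) (hv0 : ∀ x, v x ≤ 0) (hu : IsProfile v μ d H u)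
    (hH : 1 < H) (x : ℝ) : u x ≠ 0 := by
  refine ne_zero_of_periodic_of_deriv_neg hu.periodic hu.hasDerivAt (fun x hx => ?_) x
  rw [hx]
  have := hv0 x
  apply div_neg_of_neg_of_pos _ hd
  norm_num
  linarith

/-- The energy identity: the inviscid residual is of order `√d` in `L²`. -/
lemma IsProfile.integral_sq_le (hd : 0 < d) (hv : ContDiff ℝ 1 v) (hper : Function.Periodic v 1)
    (hu : IsProfile v μ d H u) {B C : ℝ} (hB : ∀ x, |u x| ≤ B) (hC : ∀ x, |deriv v x| ≤ C) :
    ∫ x in (0:ℝ)..1, (√(1 + u x ^ 2) + v x - H) ^ 2 ≤ d * (B * C) := by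
  have huc := hu.continuous
  have hvc := hv.continuous
  have hv'c : Continuous (deriv v) := hv.continuous_deriv le_rfl
  have hgc : Continuous (fun t : ℝ => √(1 + t ^ 2)) := by fun_prop
  set G := fun x => √(1 + u x ^ 2) + v x - H with hG
  have hGc : Continuous G := by fun_prop
  have hB0 : 0 ≤ B := (abs_nonneg _).trans (hB 0)
  -- The derivative of this periodic function is `G u' + u v'`, and `u' = (1 + u²) G / d`; its
  -- integral over a period is zero.
  have h1 : ∀ x, HasDerivAt (fun x => (∫ t in (0:ℝ)..(u x), √(1 + t ^ 2)) - H * u x + u x * v x)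
      ((1 + u x ^ 2) * G x ^ 2 / d + u x * deriv v x) x := by
    intro x
    have hF : HasDerivAt (fun y => ∫ t in (0:ℝ)..y, √(1 + t ^ 2)) (√(1 + u x ^ 2)) (u x) :=
      intervalIntegral.integral_hasDerivAt_right (hgc.intervalIntegrable _ _)
        hgc.stronglyMeasurable.stronglyMeasurableAtFilter hgc.continuousAt
    have hv' : HasDerivAt v (deriv v x) x := ((hv.differentiable (by norm_num)) x).hasDerivAt
    have hU := hu.hasDerivAt x
    refine (((hF.comp x hU).sub (hU.const_mul H)).add (hU.mul hv')).congr_deriv ?_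
    simp only [hG]
    ring
  have h2 : ∫ x in (0:ℝ)..1, ((1 + u x ^ 2) * G x ^ 2 / d + u x * deriv v x) = 0 := by
    rw [intervalIntegral.integral_eq_sub_of_hasDerivAt (fun x _ => h1 x)
      (Continuous.intervalIntegrable (by fun_prop) _ _)]
    have e1 := hu.periodic 0
    have e2 := hper 0
    rw [zero_add] at e1 e2
    rw [e1, e2, sub_self]
  have h3 : ∫ x in (0:ℝ)..1, (G x ^ 2 / d - B * C) ≤
      ∫ x in (0:ℝ)..1, ((1 + u x ^ 2) * G x ^ 2 / d + u x * deriv v x) := by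
    apply intervalIntegral.integral_mono zero_le_one
      (Continuous.intervalIntegrable (by fun_prop) _ _)
      (Continuous.intervalIntegrable (by fun_prop) _ _)
    intro x
    have e1 : G x ^ 2 / d ≤ (1 + u x ^ 2) * G x ^ 2 / d := by
      gcongr
      nlinarith [sq_nonneg (u x), sq_nonneg (G x), mul_nonneg (sq_nonneg (u x)) (sq_nonneg (G x))]
    have e2 : |u x * deriv v x| ≤ B * C := by
      rw [abs_mul]
      exact mul_le_mul (hB x) (hC x) (abs_nonneg _) hB0
    have := neg_abs_le (u x * deriv v x)
    simp only
    linarith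
  rw [h2, intervalIntegral.integral_sub (Continuous.intervalIntegrable (by fun_prop) _ _) (by simp),
    intervalIntegral.integral_div] at h3
  simp only [intervalIntegral.integral_const, sub_zero, smul_eq_mul, one_mul] at h3
  have h4 : (∫ x in (0:ℝ)..1, G x ^ 2) / d ≤ B * C := by linarith
  rw [div_le_iff₀ hd] at h4
  linarith

end

/-! ### Existence of profiles by shooting. -/

/-- Truncation of `x` to `[-r, r]`. -/
noncomputable def clip (r x : ℝ) : ℝ := max (-r) (min x r)

lemma clip_mem {r : ℝ} (hr : 0 ≤ r) (x : ℝ) : clip r x ∈ Icc (-r) r :=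
  ⟨le_max_left _ _, max_le (by linarith) (min_le_right _ _)⟩

lemma clip_eq_self {r x : ℝ} (h : |x| ≤ r) : clip r x = x := by
  have := abs_le.1 h
  rw [clip, min_eq_left this.2, max_eq_right this.1]

lemma eq_of_abs_clip_lt {r x : ℝ} (h : |clip r x| < r) : clip r x = x := by
  unfold clip at *
  have := abs_lt.1 h
  grind

lemma abs_clip_sub_clip_le (r x y : ℝ) : |clip r x - clip r y| ≤ |x - y| :=
  (abs_max_sub_max_le_max _ _ _ _).trans
    (max_le (by simp) ((abs_min_sub_min_le_max _ _ _ _).trans (by simp)))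

lemma continuous_clip (r : ℝ) : Continuous (clip r) := by unfold clip; fun_prop

open scoped NNReal in
/-- The flow of the truncated first order equation, with the running integral of the solution,
depends continuously on the initial value and on the level. -/
lemma exists_truncated_flow {v : ℝ → ℝ} (hv : Continuous v) (d : ℝ) {V R : ℝ}
    (hV : ∀ x, |v x| ≤ V) (hR : 0 ≤ R) :
    ∃ U W : ℝ × ℝ → ℝ → ℝ, (∀ p ∈ Icc (-R) R ×ˢ Icc (-R) R,
      U p 0 = p.1 ∧ W p 0 = 0 ∧ ∀ t ∈ Icc (0:ℝ) 1,
        HasDerivWithinAt (U p) ((1 + clip R (U p t) ^ 2) *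
          (√(1 + clip R (U p t) ^ 2) + v t - p.2) / d) (Icc 0 1) t ∧
        HasDerivWithinAt (W p) (clip R (U p t)) (Icc 0 1) t) ∧
      ContinuousOn (fun p => U p 1) (Icc (-R) R ×ˢ Icc (-R) R) ∧
      ContinuousOn (fun p => W p 1) (Icc (-R) R ×ˢ Icc (-R) R) := by
  -- The state is (solution, running integral, level). The level is a component with zero
  -- derivative, so dependence on it is dependence on initial data.
  let h : ℝ × ℝ × ℝ → ℝ × ℝ × ℝ := fun q =>
    ((1 + q.1 ^ 2) * (√(1 + q.1 ^ 2) + q.2.1 - q.2.2) / d, q.1, 0)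
  have hh : ContDiff ℝ 1 h :=
    (contDiff_rhs.div_const d).prodMk (contDiff_fst.prodMk contDiff_const)
  let T : Set (ℝ × ℝ × ℝ) := Icc (-R) R ×ˢ Icc (-V) V ×ˢ Icc (-R) R
  have hT : IsCompact T := isCompact_Icc.prod (isCompact_Icc.prod isCompact_Icc)
  obtain ⟨K, hK⟩ := exists_lipschitzOnWith_of_contDiff hT hh
  obtain ⟨L, hL⟩ := hT.exists_bound_of_continuousOn hh.continuous.continuousOn
  let f : ℝ → ℝ × ℝ × ℝ → ℝ × ℝ × ℝ := fun t p => h (clip R p.1, v t, clip R p.2.2)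
  have hmem : ∀ (t : ℝ) (p : ℝ × ℝ × ℝ), (clip R p.1, v t, clip R p.2.2) ∈ T := fun t p =>
    ⟨clip_mem hR _, abs_le.1 (hV t), clip_mem hR _⟩
  let L' : ℝ≥0 := ⟨max L 0, le_max_right _ _⟩
  let R' : ℝ≥0 := ⟨R, hR⟩
  -- The truncated field is bounded by `L'`, so data of size `R'` stay within `R' + L'` up to time
  -- one.
  have hPL : IsPicardLindelof f (tmin := 0) (tmax := 1) ⟨0, by simp⟩ (0 : ℝ × ℝ × ℝ)
      (R' + L') R' L' K := by
    refine ⟨fun t _ => ?_, fun p _ => ?_, fun t _ p _ => ?_, ?_⟩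
    · refine LipschitzOnWith.of_dist_le_mul fun p _ q _ => ?_
      refine (hK.dist_le_mul _ (hmem t p) _ (hmem t q)).trans ?_
      gcongr
      simp only [Prod.dist_eq, Real.dist_eq, sub_self, abs_zero]
      refine max_le ((abs_clip_sub_clip_le _ _ _).trans (le_max_left _ _)) (max_le
        ((abs_nonneg _).trans (le_max_left _ _)) ?_)
      exact (abs_clip_sub_clip_le _ _ _).trans
        ((le_max_right _ _).trans (le_max_right _ _))
    · have : Continuous (fun t => f t p) := hh.continuous.comp (by fun_prop)
      exact this.continuousOn
    · exact (hL _ (hmem t p)).trans (le_max_left _ _)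
    · simp
  obtain ⟨α, hα, hαc⟩ := hPL.exists_forall_mem_closedBall_eq_hasDerivWithinAt_continuousOn
  have hball : ∀ p ∈ Icc (-R) R ×ˢ Icc (-R) R,
      ((p.1, 0, p.2) : ℝ × ℝ × ℝ) ∈ Metric.closedBall (0 : ℝ × ℝ × ℝ) R' := by
    intro p hp
    rw [mem_closedBall_zero_iff]
    change max |p.1| (max |(0:ℝ)| |p.2|) ≤ R
    rw [abs_zero]
    exact max_le (abs_le.2 hp.1) (max_le hR (abs_le.2 hp.2))
  have hcont : ContinuousOn (fun p : ℝ × ℝ => α ((p.1, 0, p.2), 1)) (Icc (-R) R ×ˢ Icc (-R) R) :=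
    hαc.comp (by fun_prop) (fun p hp => ⟨hball p hp, by simp⟩)
  refine ⟨fun p t => (α ((p.1, 0, p.2), t)).1, fun p t => (α ((p.1, 0, p.2), t)).2.1,
    fun p hp => ?_, hcont.fst, hcont.snd.fst⟩
  obtain ⟨h0, h1⟩ := hα _ (hball p hp)
  have h3 : ∀ t ∈ Icc (0:ℝ) 1, (α ((p.1, 0, p.2), t)).2.2 = p.2 := by
    have := constant_of_has_deriv_right_zero (f := fun t => (α ((p.1, 0, p.2), t)).2.2)
      (a := 0) (b := 1)
      (fun t ht => (h1 t ht).continuousWithinAt.snd.snd)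
      (fun t ht => ((h1 t (Ico_subset_Icc_self ht)).mono_of_mem_nhdsWithin
        (Icc_mem_nhdsGE_of_mem ht)).snd.snd)
    intro t ht
    rw [this t ht]
    exact congrArg (fun q => q.2.2) h0
  refine ⟨congrArg (fun q => q.1) h0, congrArg (fun q => q.2.1) h0, fun t ht => ⟨?_, ?_⟩⟩
  · have := (h1 t ht).fst
    simp only [f, h] at this
    rw [h3 t ht, clip_eq_self (abs_le.2 hp.2)] at this
    exact this
  · exact (h1 t ht).snd.fst

/-- A solution on `[0, 1]` with equal end values extends to a periodic one. -/
lemma exists_periodic_extension {F : ℝ → ℝ → ℝ} (hF : Continuous fun p : ℝ × ℝ => F p.1 p.2)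
    (hFper : ∀ y, Function.Periodic (fun t => F t y) 1) {U : ℝ → ℝ} (h01 : U 0 = U 1)
    (hU : ∀ t ∈ Icc (0:ℝ) 1, HasDerivWithinAt U (F t (U t)) (Icc 0 1) t) :
    ∃ u : ℝ → ℝ, Function.Periodic u 1 ∧ (∀ t, HasDerivAt u (F t (u t)) t) ∧
      EqOn u U (Icc 0 1) := by
  have hUc : ContinuousOn U (Icc 0 1) := fun t ht => (hU t ht).continuousWithinAt
  let u : ℝ → ℝ := U ∘ Int.fract
  have huc : Continuous u := hUc.comp_fract'' h01
  have hup : Function.Periodic u 1 := fun t => by simp [u]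
  have huU : EqOn u U (Icc 0 1) := by
    intro t ht
    rcases eq_or_lt_of_le ht.2 with h | h
    · simp [u, h, h01]
    · simp [u, Int.fract_eq_self.2 ⟨ht.1, h⟩]
  let g : ℝ → ℝ := fun t => F t (u t)
  have hgc : Continuous g := hF.comp (continuous_id.prodMk huc)
  have hgp : Function.Periodic g 1 := fun t => by
    simp only [g, hup t]
    exact hFper (u t) t
  -- The primitive `I` is differentiable everywhere; identifying it with `u` avoids gluing one-sided
  -- derivatives at the integers.
  let I : ℝ → ℝ := fun t => U 0 + ∫ s in (0:ℝ)..t, g s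
  have hI : ∀ t, HasDerivAt I (g t) t := fun t =>
    (intervalIntegral.integral_hasDerivAt_right (hgc.intervalIntegrable _ _)
      hgc.stronglyMeasurable.stronglyMeasurableAtFilter hgc.continuousAt).const_add _
  have hIU : EqOn I U (Icc 0 1) := by
    apply eq_of_has_deriv_right_eq (f' := g)
      (fun t ht => (hI t).hasDerivWithinAt)
      (fun t ht => ?_) (fun t _ => (hI t).continuousAt.continuousWithinAt) hUc (by simp [I])
    have := (hU t (Ico_subset_Icc_self ht)).mono_of_mem_nhdsWithin (Icc_mem_nhdsGE_of_mem ht)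
    simpa only [g, huU (Ico_subset_Icc_self ht)] using this
  have hg0 : ∫ s in (0:ℝ)..1, g s = 0 := by
    have h1 := hIU (show (1:ℝ) ∈ Icc 0 1 by simp)
    simp only [I] at h1
    linarith
  have hIp : Function.Periodic I 1 := by
    intro t
    have h1 := hgp.intervalIntegral_add_eq t 0
    rw [zero_add, hg0] at h1
    simp only [I]
    rw [← intervalIntegral.integral_add_adjacent_intervals (hgc.intervalIntegrable 0 t)
      (hgc.intervalIntegrable t (t + 1)), h1, add_zero]
  have hIu : I = u := by
    ext t
    obtain ⟨z, hz, htz⟩ := (show Function.Periodic (fun t => I t - u t) 1 from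
      fun t => by simp only [hIp t, hup t]).exists_mem_Ico₀ one_pos t
    have hz' := Ico_subset_Icc_self hz
    have : I t - u t = I z - u z := htz
    rw [hIU hz', huU hz', sub_self] at this
    linarith
  refine ⟨u, hup, fun t => ?_, huU⟩
  have := hI t
  rwa [hIu] at this

/-- A periodic solution of the truncated equation is a profile when the truncation is far out. -/
lemma isProfile_of_truncated {v : ℝ → ℝ} {d H R V : ℝ} (hd : 0 < d)
    (hV : ∀ x, |v x| ≤ V) (hR : H + V < R) {u : ℝ → ℝ}
    (hper : Function.Periodic u 1)
    (hu : ∀ t, HasDerivAt u ((1 + clip R (u t) ^ 2) *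
          (√(1 + clip R (u t) ^ 2) + v t - H) / d) t) :
    IsProfile v (∫ x in (0:ℝ)..1, u x) d H u ∧ ∀ t, |u t| ≤ R := by
  have huc : Continuous u := continuous_iff_continuousAt.2 fun x => (hu x).continuousAt
  -- At an extremum the residual at the clipped value vanishes, so the clipped value is strictly
  -- inside the range and the truncation is inactive there.
  have key : ∀ x, IsLocalExtr u x → |u x| < R := by
    intro x hx
    have h := hx.hasDerivAt_eq_zero (hu x)
    have h1 : (0:ℝ) < 1 + clip R (u x) ^ 2 := by positivity
    have h2 : √(1 + clip R (u x) ^ 2) = H - v x := by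
      rw [div_eq_zero_iff, mul_eq_zero] at h
      rcases h with (h | h) | h <;> linarith
    have h3 := abs_le_sqrt_one_add_sq (clip R (u x))
    have h4 : |clip R (u x)| < R := by linarith [(abs_le.1 (hV x)).1]
    rwa [eq_of_abs_clip_lt h4] at h4
  obtain ⟨a, ha⟩ := exists_forall_le_of_periodic huc hper
  obtain ⟨b, hb⟩ := exists_forall_ge_of_periodic huc hper
  have h1 := abs_lt.1 (key a (Or.inr (Eventually.of_forall ha)))
  have h2 := abs_lt.1 (key b (Or.inl (Eventually.of_forall hb)))
  have h3 : ∀ t, |u t| ≤ R := fun t => abs_le.2 ⟨by linarith [hb t], by linarith [ha t]⟩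
  refine ⟨⟨hper, fun t => ?_, rfl⟩, h3⟩
  have := hu t
  rwa [clip_eq_self (h3 t)] at this

/-- A profile starting far away from `μ` stays on the same side of `μ`. -/
lemma IsProfile.ne_of_large {v : ℝ → ℝ} {m μ d H V A : ℝ} {u : ℝ → ℝ} (hd : 0 < d)
    (hV : ∀ x, |v x| ≤ V) (hu : IsProfile v m d H u) (hA0 : A ≤ |u 0|) (hA : 0 ≤ A)
    (hA1 : √(1 + μ ^ 2) + 2 * V < √(1 + A ^ 2)) (x : ℝ) : u x ≠ μ := by
  -- An extremum of `u` lies at least as far from zero as `u 0`, and there `H = √(1 + u²) + v`. With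
  -- `H` this large, the value `μ` could be crossed only downwards.
  have hH : √(1 + A ^ 2) - V ≤ H := by
    rcases le_abs'.1 hA0 with h | h
    · obtain ⟨b, hb⟩ := exists_forall_ge_of_periodic hu.continuous hu.periodic
      have h2 := hu.sqrt_eq_of_isLocalExtr hd (x := b) (Or.inl (Eventually.of_forall hb))
      have h3 : √(1 + A ^ 2) ≤ √(1 + u b ^ 2) := by
        rw [sqrt_one_add_sq_le_iff, abs_of_nonneg hA, abs_of_nonpos] <;> linarith [hb 0]
      linarith [(abs_le.1 (hV b)).1]
    · obtain ⟨b, hb⟩ := exists_forall_le_of_periodic hu.continuous hu.periodic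
      have h2 := hu.sqrt_eq_of_isLocalExtr hd (x := b) (Or.inr (Eventually.of_forall hb))
      have h3 : √(1 + A ^ 2) ≤ √(1 + u b ^ 2) := by
        rw [sqrt_one_add_sq_le_iff, abs_of_nonneg hA, abs_of_nonneg] <;> linarith [hb 0]
      linarith [(abs_le.1 (hV b)).1]
  intro hx
  refine ne_zero_of_periodic_of_deriv_neg (f := fun x => u x - μ)
    (fun x => by simp [hu.periodic x])
    (fun x => (hu.hasDerivAt x).sub_const μ) (fun x hx => ?_) x (by linarith)
  have h1 : u x = μ := by linarith
  rw [h1]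
  have := (abs_le.1 (hV x)).2
  apply div_neg_of_neg_of_pos _ hd
  apply mul_neg_of_pos_of_neg (by positivity) (by linarith)

/-- For each initial value `a` in `[-A, A]` the intermediate value theorem gives a level at which
the flow returns to `a`, and that level is unique because profiles of different levels cannot meet.
The values `a` with mean at most `μ`, and those with mean at least `μ`, form closed sets, as
projections of compact sets. They are nonempty and cover a connected interval, so they intersect;
there the levels coincide and the mean is `μ`. -/
theorem exists_isProfile {v : ℝ → ℝ} (hv : Continuous v) (hper : Function.Periodic v 1)
    (μ : ℝ) {d : ℝ} (hd : 0 < d) : ∃ H u, IsProfile v μ d H u := by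
  obtain ⟨x₀, hx₀⟩ := exists_forall_le_of_periodic (f := fun x => |v x|) hv.abs
    (fun x => by simp [hper x])
  obtain ⟨V, hV0, hV⟩ : ∃ V, 0 ≤ V ∧ ∀ x, |v x| ≤ V := ⟨|v x₀|, abs_nonneg _, hx₀⟩
  -- `A` makes profiles starting at `±A` avoid `μ`; `B` makes constants in `[-A, A]` crossable only
  -- downwards at level `B` and only upwards at `-B`; `R` exceeds `H + V` for all levels used, so
  -- the truncation is inactive on periodic solutions.
  obtain ⟨A, hA0, hAμ, hA⟩ : ∃ A, 0 ≤ A ∧ |μ| < A ∧ √(1 + μ ^ 2) + 2 * V < √(1 + A ^ 2) := by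
    refine ⟨√(1 + μ ^ 2) + 2 * V + 1, by positivity, ?_, ?_⟩
    · linarith [abs_le_sqrt_one_add_sq μ]
    · exact lt_of_lt_of_le (by linarith) ((le_abs_self _).trans (abs_le_sqrt_one_add_sq _))
  set B := √(1 + A ^ 2) + V + 1 with hB
  have hAB : A ≤ B := by linarith [(le_abs_self _).trans (abs_le_sqrt_one_add_sq A)]
  set R := B + V + 1 with hR
  have hR0 : 0 ≤ R := by linarith
  obtain ⟨U, W, hUW, hUc, hWc⟩ := exists_truncated_flow hv d hV hR0
  set D : Set (ℝ × ℝ) := Icc (-A) A ×ˢ Icc (-B) B with hD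
  have hDR : D ⊆ Icc (-R) R ×ˢ Icc (-R) R := by
    rintro p ⟨⟨h1, h2⟩, h3, h4⟩
    refine ⟨⟨?_, ?_⟩, ?_, ?_⟩ <;> linarith
  set S : Set (ℝ × ℝ) := D ∩ {p | U p 1 = p.1} with hS
  have hDcomp : IsCompact D := isCompact_Icc.prod isCompact_Icc
  have hScl : IsClosed S := by
    have := (hUc.mono hDR).sub continuous_fst.continuousOn
    have h2 := this.preimage_isClosed_of_isClosed hDcomp.isClosed (isClosed_singleton (x := (0:ℝ)))
    convert h2 using 1
    ext p
    simp [hS, sub_eq_zero]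
  have hScomp : IsCompact S := hDcomp.of_isClosed_subset hScl inter_subset_left
  -- points of `S` are initial data of profiles
  have hprof : ∀ p ∈ S, ∃ u, IsProfile v (W p 1) d p.2 u ∧ u 0 = p.1 := by
    rintro p ⟨hpD, hp1⟩
    have hp1 : U p 1 = p.1 := hp1
    obtain ⟨h0, hW0, hder⟩ := hUW p (hDR hpD)
    have hcl := continuous_clip R
    obtain ⟨u, hup, hu, huU⟩ := exists_periodic_extension
      (F := fun t y => (1 + clip R y ^ 2) * (√(1 + clip R y ^ 2) + v t - p.2) / d)
      (by fun_prop) (fun y t => by simp only [hper t]) (U := U p) (by rw [h0, hp1])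
      (fun t ht => (hder t ht).1)
    obtain ⟨hprof, hbd⟩ := isProfile_of_truncated hd hV (by linarith [hpD.2.2]) hup hu
    have hWu : ∫ x in (0:ℝ)..1, u x = W p 1 := by
      rw [intervalIntegral.integral_eq_sub_of_hasDerivAt_of_le (f := W p) zero_le_one
        (fun t ht => (hder t ht).2.continuousWithinAt) (fun t ht => ?_)
        (hprof.continuous.intervalIntegrable _ _), hW0, sub_zero]
      have ht' := Ioo_subset_Icc_self ht
      have := ((hder t ht').2).hasDerivAt (Icc_mem_nhds ht.1 ht.2)
      rwa [← huU ht', clip_eq_self (hbd t)] at this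
    rw [hWu] at hprof
    exact ⟨u, hprof, by rw [huU (by simp), h0]⟩
  -- every initial value in `[-A, A]` occurs
  have hsurj : ∀ a ∈ Icc (-A) A, ∃ H, (a, H) ∈ S := by
    intro a ha
    have haR : |a| ≤ R := (abs_le.2 ha).trans (by linarith)
    have hBm : B ∈ Icc (-B) B := ⟨by linarith, le_rfl⟩
    have hBm' : -B ∈ Icc (-B) B := ⟨le_rfl, by linarith⟩
    have hc : ContinuousOn (fun H => U (a, H) 1) (Icc (-B) B) :=
      (hUc.mono hDR).comp (by fun_prop) (fun H hH => ⟨ha, hH⟩)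
    have hle : U (a, B) 1 ≤ a := by
      obtain ⟨h0, -, hder⟩ := hUW (a, B) (hDR ⟨ha, hBm⟩)
      have := nonpos_of_deriv_neg_of_eq_zero (f := fun t => U (a, B) t - a)
        (fun t ht => ((hder t ht).1).sub_const a) (fun t ht h => ?_) (by simp [h0]) 1 (by simp)
      · linarith
      · have h1 : U (a, B) t = a := by linarith
        rw [h1, clip_eq_self haR]
        apply div_neg_of_neg_of_pos _ hd
        apply mul_neg_of_pos_of_neg (by positivity)
        have : √(1 + a ^ 2) ≤ √(1 + A ^ 2) := by
          rw [sqrt_one_add_sq_le_iff, abs_of_nonneg hA0]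
          exact abs_le.2 ha
        simp only
        linarith [(abs_le.1 (hV t)).2]
    have hge : a ≤ U (a, -B) 1 := by
      obtain ⟨h0, -, hder⟩ := hUW (a, -B) (hDR ⟨ha, hBm'⟩)
      have := nonneg_of_deriv_pos_of_eq_zero (f := fun t => U (a, -B) t - a)
        (fun t ht => ((hder t ht).1).sub_const a) (fun t ht h => ?_) (by simp [h0]) 1 (by simp)
      · linarith
      · have h1 : U (a, -B) t = a := by linarith
        rw [h1, clip_eq_self haR]
        apply div_pos _ hd
        apply mul_pos (by positivity)
        simp only
        linarith [(abs_le.1 (hV t)).1, Real.sqrt_nonneg (1 + a ^ 2), Real.sqrt_nonneg (1 + A ^ 2)]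
    obtain ⟨H, hH, hHa⟩ := intermediate_value_Icc' (by linarith : -B ≤ B) hc ⟨hle, hge⟩
    exact ⟨H, ⟨ha, hH⟩, hHa⟩
  have hWS : ContinuousOn (fun p => W p 1) S := hWc.mono (inter_subset_left.trans hDR)
  have hclosed : ∀ T : Set ℝ, IsClosed T →
      IsClosed (Prod.fst '' (S ∩ (fun p => W p 1) ⁻¹' T)) := fun T hT =>
    ((hScomp.of_isClosed_subset (hWS.preimage_isClosed_of_isClosed hScl hT)
      inter_subset_left).image continuous_fst).isClosed
  have hAm : A ∈ Icc (-A) A := ⟨by linarith, le_rfl⟩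
  have hAm' : -A ∈ Icc (-A) A := ⟨le_rfl, by linarith⟩
  have hμA := abs_lt.1 hAμ
  obtain ⟨a, -, ⟨⟨_, H₁⟩, ⟨hS₁, hle⟩, rfl⟩, ⟨⟨_, H₂⟩, ⟨hS₂, hge⟩, rfl⟩⟩ :=
    isPreconnected_closed_iff.1 (isPreconnected_Icc (a := -A) (b := A)) _ _
      (hclosed (Iic μ) isClosed_Iic) (hclosed (Ici μ) isClosed_Ici)
      (fun a ha => by
        obtain ⟨H, hH⟩ := hsurj a ha
        rcases le_total (W (a, H) 1) μ with h | h
        · exact Or.inl ⟨_, ⟨hH, h⟩, rfl⟩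
        · exact Or.inr ⟨_, ⟨hH, h⟩, rfl⟩)
      (by
        obtain ⟨H, hH⟩ := hsurj _ hAm'
        refine ⟨-A, hAm', _, ⟨hH, ?_⟩, rfl⟩
        obtain ⟨u, hu, hu0⟩ := hprof _ hH
        have hne := hu.ne_of_large hd hV (A := A) (by rw [hu0]; simp [le_abs_self]) hA0 hA
        rcases pos_or_neg_of_ne_zero (f := fun x => u x - μ)
          (hu.continuous.sub continuous_const) (fun x => sub_ne_zero.2 (hne x)) with h | h
        · have := h 0
          rw [hu0] at this
          simp only at this
          linarith
        · change W (-A, H) 1 ≤ μ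
          rw [← hu.mean]
          have := intervalIntegral.integral_mono (μ := MeasureTheory.volume) zero_le_one
            (hu.continuous.intervalIntegrable 0 1)
            (continuous_const (y := μ) |>.intervalIntegrable 0 1)
            (fun x => by have := h x; linarith)
          simpa using this)
      (by
        obtain ⟨H, hH⟩ := hsurj _ hAm
        refine ⟨A, hAm, _, ⟨hH, ?_⟩, rfl⟩
        obtain ⟨u, hu, hu0⟩ := hprof _ hH
        have hne := hu.ne_of_large hd hV (A := A) (by rw [hu0]; simp [le_abs_self]) hA0 hA
        rcases pos_or_neg_of_ne_zero (f := fun x => u x - μ)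
          (hu.continuous.sub continuous_const) (fun x => sub_ne_zero.2 (hne x)) with h | h
        · change μ ≤ W (A, H) 1
          rw [← hu.mean]
          have := intervalIntegral.integral_mono (μ := MeasureTheory.volume) zero_le_one
            (continuous_const (y := μ) |>.intervalIntegrable 0 1) (hu.continuous.intervalIntegrable 0 1)
            (fun x => by have := h x; linarith)
          simpa using this
        · have := h 0
          rw [hu0] at this
          simp only at this
          linarith)
  obtain ⟨u₁, hu₁, h₁⟩ := hprof _ hS₁
  obtain ⟨u₂, hu₂, h₂⟩ := hprof _ hS₂
  have hH : H₁ = H₂ := by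
    have h12 : u₁ 0 = u₂ 0 := by rw [h₁, h₂]
    exact le_antisymm (hu₂.level_le_of_eq hd hu₁ h12.symm) (hu₁.level_le_of_eq hd hu₂ h12)
  subst hH
  have hW := le_antisymm (show W _ 1 ≤ μ from hle) (show μ ≤ W _ 1 from hge)
  rw [hW] at hu₁
  exact ⟨_, u₁, hu₁⟩

theorem existsUnique_isCellSolution {v : ℝ → ℝ} (hv : Continuous v) (hper : Function.Periodic v 1)
    (μ : ℝ) {d : ℝ} (hd : 0 < d) :
    ∃! Hw : ℝ × (ℝ → ℝ), IsCellSolution v μ d Hw.1 Hw.2 := by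
  obtain ⟨H, u, hu⟩ := exists_isProfile hv hper μ hd
  obtain ⟨w, hw⟩ : ∃ w, IsCellSolution v μ d H w := ⟨_, hu.isCellSolution hd hv⟩
  refine ⟨(H, w), hw, ?_⟩
  rintro ⟨H', w'⟩ hw'
  have hw' : IsCellSolution v μ d H' w' := hw'
  obtain ⟨hH, he⟩ := (hw'.isProfile hd).unique hd hv hper (hw.isProfile hd)
  refine Prod.ext hH ?_
  refine eq_of_fderiv_eq (𝕜 := ℝ) (x := 0) (fun x => (hw'.hasDerivAt x).differentiableAt)
    (fun x => (hw.hasDerivAt x).differentiableAt) (fun x => ?_)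
    (hw'.normalized.trans hw.normalized.symm)
  have := congrFun he x
  ext
  simpa using this

/-! ### Limit of the level and `L¹` convergence of `|u|`. -/

/-- The residual controls `u² - slope²`, and the square root is not Lipschitz where the slope
vanishes. The loss `η` pays for this: if `|a - b| > η`, then `|a - b| η³ ≤ |a - b|⁴ ≤ (a² - b²)²`.
-/
lemma abs_sub_le_add_sq_sub_sq {a b η : ℝ} (ha : 0 ≤ a) (hb : 0 ≤ b) (hη : 0 < η) :
    |a - b| ≤ η + (a ^ 2 - b ^ 2) ^ 2 / η ^ 3 := by
  rcases le_or_gt |a - b| η with h | h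
  · have : 0 ≤ (a ^ 2 - b ^ 2) ^ 2 / η ^ 3 := by positivity
    linarith
  · have h1 : |a - b| ≤ a + b := by rw [abs_le]; constructor <;> linarith
    have h2 : |a - b| ^ 2 ≤ |a ^ 2 - b ^ 2| := by
      rw [show a ^ 2 - b ^ 2 = (a - b) * (a + b) by ring, abs_mul,
        abs_of_nonneg (by linarith : 0 ≤ a + b), sq]
      exact mul_le_mul_of_nonneg_left h1 (abs_nonneg _)
    have h3 : |a - b| ^ 4 ≤ (a ^ 2 - b ^ 2) ^ 2 := by
      rw [← sq_abs (a ^ 2 - b ^ 2), show |a - b| ^ 4 = (|a - b| ^ 2) ^ 2 by ring]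
      gcongr
    have h4 : |a - b| * η ^ 3 ≤ |a - b| ^ 4 := by
      rw [show |a - b| ^ 4 = |a - b| * |a - b| ^ 3 by ring]
      gcongr
    have h5 : |a - b| ≤ (a ^ 2 - b ^ 2) ^ 2 / η ^ 3 := by
      rw [le_div_iff₀ (by positivity)]
      linarith
    linarith

lemma eventually_mul_lt (E : ℝ) {ε : ℝ} (hε : 0 < ε) : ∀ᶠ d in 𝓝[>] (0:ℝ), d * E < ε := by
  have : Tendsto (fun d : ℝ => d * E) (𝓝[>] 0) (𝓝 0) := by
    have : Continuous (fun d : ℝ => d * E) := by fun_prop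
    exact (this.tendsto' 0 0 (by simp)).mono_left nhdsWithin_le_nhds
  exact this.eventually_lt_const hε

section
variable {v : ℝ → ℝ}

lemma slope_nonneg (x : ℝ) : 0 ≤ slope v x := Real.sqrt_nonneg _

lemma slope_sq (hv0 : ∀ x, v x ≤ 0) (x : ℝ) : slope v x ^ 2 = (1 - v x) ^ 2 - 1 :=
  Real.sq_sqrt (by nlinarith [hv0 x])

lemma continuous_slope (hv : Continuous v) : Continuous (slope v) := by
  unfold slope; fun_prop

lemma periodic_slope (hper : Function.Periodic v 1) : Function.Periodic (slope v) 1 :=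
  fun x => by simp [slope, hper x]

lemma slope_eq_zero_iff (hv0 : ∀ x, v x ≤ 0) {x : ℝ} : slope v x = 0 ↔ v x = 0 := by
  rw [← sq_eq_zero_iff, slope_sq hv0]
  constructor
  · intro h
    nlinarith [hv0 x]
  · intro h
    simp [h]

lemma sqrt_one_add_sq_le_iff_abs_le_slope (hv0 : ∀ x, v x ≤ 0) {a x : ℝ} :
    √(1 + a ^ 2) ≤ 1 - v x ↔ |a| ≤ slope v x := by
  rw [Real.sqrt_le_left (by linarith [hv0 x]), ← abs_of_nonneg (slope_nonneg (v := v) x),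
    ← sq_le_sq, slope_sq hv0]
  constructor <;> intro h <;> linarith

lemma le_sqrt_one_add_sq_iff_slope_le_abs (hv0 : ∀ x, v x ≤ 0) {a x : ℝ} :
    1 - v x ≤ √(1 + a ^ 2) ↔ slope v x ≤ |a| := by
  rw [Real.le_sqrt' (by linarith [hv0 x]), ← abs_of_nonneg (slope_nonneg (v := v) x),
    ← sq_le_sq, slope_sq hv0]
  constructor <;> intro h <;> linarith

lemma abs_abs_sub_slope_le (hv0 : ∀ x, v x ≤ 0) {V B : ℝ} (hV : ∀ x, -V ≤ v x) {x a η : ℝ}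
    (hη : 0 < η) (ha : |a| ≤ B) :
    |(|a| - slope v x)| ≤
      η + (2 + B + V) ^ 2 / η ^ 3 * (√(1 + a ^ 2) + v x - 1) ^ 2 := by
  refine (abs_sub_le_add_sq_sub_sq (abs_nonneg a) (slope_nonneg x) hη).trans ?_
  have h1 : √(1 + a ^ 2) ≤ 1 + B := by
    rw [Real.sqrt_le_left (by linarith [abs_nonneg a]), ← sq_abs a]
    nlinarith [abs_nonneg a]
  have h0 := one_le_sqrt_one_add_sq a
  have h2 : |a| ^ 2 - slope v x ^ 2 = (√(1 + a ^ 2) + v x - 1) * (√(1 + a ^ 2) + 1 - v x) := by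
    have h3 : √(1 + a ^ 2) ^ 2 = 1 + a ^ 2 := Real.sq_sqrt (by positivity)
    rw [slope_sq hv0, sq_abs]
    linear_combination -h3
  rw [h2, mul_pow, div_mul_eq_mul_div, mul_comm ((2 + B + V) ^ 2)]
  have := hV x
  have := hv0 x
  gcongr
  · linarith
  · linarith

variable {μ : ℝ}

/-- Bounds on profiles and on the `L²` norm of the inviscid residual that are uniform in `d`. -/
lemma exists_uniform_bounds (hv : ContDiff ℝ 1 v) (hper : Function.Periodic v 1)
    (hv0 : ∀ x, v x ≤ 0) (μ : ℝ) : ∃ B V E : ℝ, 0 ≤ B ∧ 0 ≤ V ∧ 0 ≤ E ∧ (∀ x, -V ≤ v x) ∧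
      ∀ d, 0 < d → ∀ H u, IsProfile v μ d H u → (∀ x, |u x| ≤ B) ∧
        ∫ x in (0:ℝ)..1, (√(1 + u x ^ 2) + v x - H) ^ 2 ≤ d * E := by
  obtain ⟨a, ha⟩ := exists_forall_ge_of_periodic hv.continuous hper
  obtain ⟨b, hb⟩ := exists_forall_le_of_periodic (f := fun x => |deriv v x|)
    (hv.continuous_deriv le_rfl).abs (fun x => by
      simp only
      rw [← deriv_comp_add_const, funext hper])
  have h0 := one_le_sqrt_one_add_sq μ
  have h1 := hv0 a
  refine ⟨√(1 + μ ^ 2) - v a, - v a, (√(1 + μ ^ 2) - v a) * |deriv v b|, by linarith, by linarith,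
    mul_nonneg (by linarith) (abs_nonneg _), by simpa using ha, fun d hd H u hu => ?_⟩
  have hB : ∀ x, |u x| ≤ √(1 + μ ^ 2) - v a := fun x => by
    have := hu.abs_apply_le hd (V := - v a) (by simpa using ha) x
    linarith [hu.level_le_sqrt hd hv0]
  exact ⟨hB, hu.integral_sq_le hd hv hper hB hb⟩

/-- If `H > 1` the profile has constant sign, so `∫ |u| = |μ|`. The energy bound prevents `|u|` from
falling much below the slope in mean, against the strict inequality for `μ`. -/
lemma eventually_level_le_one (hv : ContDiff ℝ 1 v) (hper : Function.Periodic v 1)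
    (hv0 : ∀ x, v x ≤ 0) (hμ : |μ| < ∫ y in (0:ℝ)..1, slope v y) :
    ∀ᶠ d in 𝓝[>] (0:ℝ), ∀ H u, IsProfile v μ d H u → H ≤ 1 := by
  obtain ⟨B, V, E, hB, hV, hE, hVv, hest⟩ := exists_uniform_bounds hv hper hv0 μ
  set η := ((∫ y in (0:ℝ)..1, slope v y) - |μ|) / 3 with hη
  have hη0 : 0 < η := by rw [hη]; linarith
  filter_upwards [self_mem_nhdsWithin, eventually_mul_lt ((2 + B + V) ^ 2 / η ^ 3 * E) hη0]
    with d hd hsmall H u hu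
  by_contra! hH
  obtain ⟨hub, hint⟩ := hest d hd H u hu
  have huc := hu.continuous
  have hvc := hv.continuous
  have hsc := continuous_slope hvc
  have habs : ∫ x in (0:ℝ)..1, |u x| = |μ| := by
    rw [← hu.mean]
    rcases pos_or_neg_of_ne_zero huc (hu.ne_zero hd hv0 hH) with h | h
    · rw [abs_of_nonneg (intervalIntegral.integral_nonneg zero_le_one (fun x _ => (h x).le))]
      simp only [fun x => abs_of_pos (h x)]
    · rw [abs_of_nonpos]
      · simp only [fun x => abs_of_neg (h x), intervalIntegral.integral_neg]
      · rw [← neg_nonneg, ← intervalIntegral.integral_neg]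
        exact intervalIntegral.integral_nonneg zero_le_one (fun x _ => by linarith [h x])
  have hpt : ∀ x, slope v x - |u x| ≤
      η + (2 + B + V) ^ 2 / η ^ 3 * (√(1 + u x ^ 2) + v x - H) ^ 2 := by
    intro x
    rcases le_total (slope v x) |u x| with h | h
    · have : 0 ≤ η + (2 + B + V) ^ 2 / η ^ 3 * (√(1 + u x ^ 2) + v x - H) ^ 2 := by positivity
      linarith
    · have h1 := abs_abs_sub_slope_le hv0 hVv hη0 (hub x) (x := x)
      rw [abs_sub_comm, abs_of_nonneg (by linarith)] at h1
      refine h1.trans ?_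
      have h2 := (sqrt_one_add_sq_le_iff_abs_le_slope hv0).2 h
      -- Where `|u| ≤ slope` the residual at level `1` is nonpositive; raising the level to `H` only
      -- enlarges its square.
      have h3 : (√(1 + u x ^ 2) + v x - 1) ^ 2 ≤ (√(1 + u x ^ 2) + v x - H) ^ 2 := by nlinarith
      gcongr
  have hI := intervalIntegral.integral_mono (μ := MeasureTheory.volume) (zero_le_one' ℝ)
    (Continuous.intervalIntegrable (by fun_prop) _ _)
    (Continuous.intervalIntegrable (by fun_prop) _ _) hpt
  rw [intervalIntegral.integral_sub (hsc.intervalIntegrable _ _)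
    (huc.abs.intervalIntegrable _ _), habs,
    intervalIntegral.integral_add (by simp) (Continuous.intervalIntegrable (by fun_prop) _ _),
    intervalIntegral.integral_const_mul] at hI
  simp only [intervalIntegral.integral_const, sub_zero, smul_eq_mul, one_mul] at hI
  have h4 : (2 + B + V) ^ 2 / η ^ 3 * ∫ x in (0:ℝ)..1, (√(1 + u x ^ 2) + v x - H) ^ 2 ≤
      (2 + B + V) ^ 2 / η ^ 3 * (d * E) := by gcongr
  have h5 : (2 + B + V) ^ 2 / η ^ 3 * (d * E) = d * ((2 + B + V) ^ 2 / η ^ 3 * E) := by ring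
  linarith

/-- Near `a` one has `√(1 + u²) + v > 1 - η / 2`. A level below `1 - η` would keep the residual
above `η / 2` on an interval of fixed length, against the energy bound. -/
lemma eventually_le_level (hv : ContDiff ℝ 1 v) (hper : Function.Periodic v 1)
    (hv0 : ∀ x, v x ≤ 0) (μ : ℝ) {a : ℝ} (ha : v a = 0) {η : ℝ} (hη : 0 < η) :
    ∀ᶠ d in 𝓝[>] (0:ℝ), ∀ H u, IsProfile v μ d H u → 1 - η ≤ H := by
  obtain ⟨B, V, E, hB, hV, hE, hVv, hest⟩ := exists_uniform_bounds hv hper hv0 μ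
  have hvc := hv.continuous
  obtain ⟨ρ, hρ, hρv⟩ := Metric.eventually_nhds_iff.1
    (hvc.continuousAt.eventually_const_lt (show -(η / 2) < v a by rw [ha]; linarith))
  set r := min (ρ / 2) 1 with hr
  have hr0 : 0 < r := by positivity
  have hr1 : r ≤ 1 := min_le_right _ _
  have hr2 : r ≤ ρ / 2 := min_le_left _ _
  have hpos : 0 < r * (η / 2) ^ 2 := by positivity
  filter_upwards [self_mem_nhdsWithin, eventually_mul_lt E hpos] with d hd hsmall H u hu
  by_contra! hH
  obtain ⟨hub, hint⟩ := hest d hd H u hu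
  have huc := hu.continuous
  have hp : Function.Periodic (fun x => (√(1 + u x ^ 2) + v x - H) ^ 2) 1 := fun x => by
    simp only [hu.periodic x, hper x]
  have h1 := hp.intervalIntegral_add_eq a 0
  rw [zero_add] at h1
  have hGc : Continuous (fun x => (√(1 + u x ^ 2) + v x - H) ^ 2) := by fun_prop
  have h2 : ∫ x in a..(a + r), (√(1 + u x ^ 2) + v x - H) ^ 2 ≤
      ∫ x in a..(a + 1), (√(1 + u x ^ 2) + v x - H) ^ 2 :=
    intervalIntegral.integral_mono_interval le_rfl (by linarith) (by linarith)
      (Eventually.of_forall fun x => sq_nonneg _) (hGc.intervalIntegrable _ _)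
  have h3 : ∫ x in a..(a + r), (η / 2) ^ 2 ≤
      ∫ x in a..(a + r), (√(1 + u x ^ 2) + v x - H) ^ 2 := by
    refine intervalIntegral.integral_mono_on (by linarith) (by simp) (hGc.intervalIntegrable _ _)
      (fun x hx => ?_)
    have h4 : -(η / 2) < v x := hρv (by
      rw [Real.dist_eq, abs_of_nonneg (by linarith [hx.1])]
      linarith [hx.2])
    have h5 := one_le_sqrt_one_add_sq (u x)
    gcongr
    linarith
  simp only [intervalIntegral.integral_const, smul_eq_mul, add_sub_cancel_left] at h3
  linarith

/-- The modulus of the profile converges to the inviscid slope in `L¹`. -/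
lemma eventually_integral_abs_sub_le (hv : ContDiff ℝ 1 v) (hper : Function.Periodic v 1)
    (hv0 : ∀ x, v x ≤ 0) {a : ℝ} (ha : v a = 0) (hμ : |μ| < ∫ y in (0:ℝ)..1, slope v y)
    (b : ℝ) {ε : ℝ} (hε : 0 < ε) :
    ∀ᶠ d in 𝓝[>] (0:ℝ), ∀ H u, IsProfile v μ d H u →
      ∫ x in b..(b + 1), |(|u x| - slope v x)| ≤ ε := by
  obtain ⟨B, V, E, hB, hV, hE, hVv, hest⟩ := exists_uniform_bounds hv hper hv0 μ
  have hvc := hv.continuous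
  have hsc := continuous_slope hvc
  set η := ε / 3 with hη
  have hη0 : 0 < η := by positivity
  set M := (2 + B + V) ^ 2 / η ^ 3 with hM
  have hM0 : 0 < M := by positivity
  obtain ⟨τ, hτ0, hτ⟩ : ∃ τ : ℝ, 0 < τ ∧ M * (2 * τ ^ 2) ≤ η := by
    refine ⟨√(η / (2 * M)), by positivity, ?_⟩
    rw [Real.sq_sqrt (by positivity)]
    field_simp
    rfl
  filter_upwards [self_mem_nhdsWithin, eventually_level_le_one hv hper hv0 hμ,
    eventually_le_level hv hper hv0 μ ha hτ0, eventually_mul_lt (M * 2 * E) hη0]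
    with d hd hle hge hsmall H u hu
  obtain ⟨hub, hint⟩ := hest d hd H u hu
  have hle := hle H u hu
  have hge := hge H u hu
  have huc := hu.continuous
  have hp : Function.Periodic (fun x => |(|u x| - slope v x)|) 1 := fun x => by
    simp only [hu.periodic x, periodic_slope hper x]
  rw [hp.intervalIntegral_add_eq b 0, zero_add]
  have hpt : ∀ x, |(|u x| - slope v x)| ≤
      η + (M * 2 * (√(1 + u x ^ 2) + v x - H) ^ 2 + M * (2 * τ ^ 2)) := by
    intro x
    refine (abs_abs_sub_slope_le hv0 hVv hη0 (hub x) (x := x)).trans ?_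
    have h1 : (√(1 + u x ^ 2) + v x - 1) ^ 2 ≤
        2 * (√(1 + u x ^ 2) + v x - H) ^ 2 + 2 * τ ^ 2 := by
      nlinarith [sq_nonneg ((√(1 + u x ^ 2) + v x - H) - (H - 1))]
    have h2 : M * (√(1 + u x ^ 2) + v x - 1) ^ 2 ≤
        M * (2 * (√(1 + u x ^ 2) + v x - H) ^ 2 + 2 * τ ^ 2) := by gcongr
    linarith
  have hI := intervalIntegral.integral_mono (μ := MeasureTheory.volume) (zero_le_one' ℝ)
    (Continuous.intervalIntegrable (by fun_prop) _ _)
    (Continuous.intervalIntegrable (by fun_prop) _ _) hpt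
  rw [intervalIntegral.integral_add (by simp) (Continuous.intervalIntegrable (by fun_prop) _ _),
    intervalIntegral.integral_add (Continuous.intervalIntegrable (by fun_prop) _ _) (by simp),
    intervalIntegral.integral_const_mul] at hI
  simp only [intervalIntegral.integral_const, sub_zero, smul_eq_mul, one_mul] at hI
  have h4 : M * 2 * ∫ x in (0:ℝ)..1, (√(1 + u x ^ 2) + v x - H) ^ 2 ≤
      M * 2 * (d * E) := by gcongr
  have h5 : M * 2 * (d * E) = d * (M * 2 * E) := by ring
  linarith

end

/-! ### Second order behaviour at maxima and the sharp lower bound on the level. -/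

section
variable {v : ℝ → ℝ} {μ : ℝ}

lemma hasDerivAt_of_contDiff_two (hv : ContDiff ℝ 2 v) (x : ℝ) : HasDerivAt v (deriv v x) x :=
  ((hv.differentiable (by norm_num)) x).hasDerivAt

lemma hasDerivAt_deriv_of_contDiff_two (hv : ContDiff ℝ 2 v) (x : ℝ) :
    HasDerivAt (deriv v) (deriv (deriv v) x) x :=
  (hv.differentiable_deriv_two x).hasDerivAt

lemma deriv_eq_zero_of_max (hv0 : ∀ x, v x ≤ 0) {a : ℝ} (ha : v a = 0) : deriv v a = 0 :=
  IsLocalMax.deriv_eq_zero (Eventually.of_forall fun x => by rw [ha]; exact hv0 x)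

lemma eventually_le_of_second_deriv_pos {h h' : ℝ → ℝ} {h'' a : ℝ}
    (hh : ∀ x, HasDerivAt h (h' x) x) (hh' : HasDerivAt h' h'' a) (h1 : h' a = 0) (h2 : 0 < h'') :
    ∀ᶠ x in 𝓝 a, h a ≤ h x := by
  have e : deriv h = h' := funext fun x => (hh x).deriv
  exact isLocalMin_of_deriv_deriv_pos (by rw [e, hh'.deriv]; exact h2) (by rw [e, h1])
    (hh a).continuousAt

lemma second_deriv_nonpos_of_max (hv : ContDiff ℝ 2 v) (hv0 : ∀ x, v x ≤ 0) {a : ℝ}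
    (ha : v a = 0) : deriv (deriv v) a ≤ 0 := by
  by_contra! h
  have h1 : ∀ᶠ x in 𝓝 a, v a ≤ v x := eventually_le_of_second_deriv_pos
    (hasDerivAt_of_contDiff_two hv) (hasDerivAt_deriv_of_contDiff_two hv a)
    (deriv_eq_zero_of_max hv0 ha) h
  have h2 : v =ᶠ[𝓝 a] fun _ => 0 := by
    filter_upwards [h1] with x hx
    exact le_antisymm (hv0 x) (by linarith)
  have h3 := h2.deriv.deriv_eq
  simp at h3
  linarith

/-- Near a maximum point the slope is below any line steeper than `√|v''|`. -/
lemma eventually_slope_le (hv : ContDiff ℝ 2 v) (hv0 : ∀ x, v x ≤ 0) {a κ : ℝ} (ha : v a = 0)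
    (hκ0 : 0 ≤ κ) (hκ : |deriv (deriv v) a| < κ ^ 2) :
    ∀ᶠ x in 𝓝 a, slope v x ≤ κ * |x - a| := by
  have hd := hasDerivAt_of_contDiff_two hv
  have hdd := hasDerivAt_deriv_of_contDiff_two hv a
  have h0 := deriv_eq_zero_of_max hv0 ha
  -- Squares are compared: this difference vanishes to first order at `a` and has second derivative
  -- `2 (κ² + v''(a)) > 0` there.
  have h1 : ∀ x, HasDerivAt (fun x => κ ^ 2 * (x - a) ^ 2 - ((1 - v x) ^ 2 - 1))
      (κ ^ 2 * (2 * (x - a)) + 2 * ((1 - v x) * deriv v x)) x := by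
    intro x
    refine (((((hasDerivAt_id x).sub_const a).pow 2).const_mul (κ ^ 2)).sub
      ((((hd x).const_sub 1).pow 2).sub_const 1)).congr_deriv ?_
    simp
    ring
  have h2 : HasDerivAt (fun x => κ ^ 2 * (2 * (x - a)) + 2 * ((1 - v x) * deriv v x))
      (2 * (κ ^ 2 + deriv (deriv v) a)) a := by
    refine (((((hasDerivAt_id a).sub_const a).const_mul 2).const_mul (κ ^ 2)).add
      ((((hd a).const_sub 1).mul hdd).const_mul 2)).congr_deriv ?_
    simp [h0, ha]
    ring
  have h3 := neg_abs_le (deriv (deriv v) a)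
  filter_upwards [eventually_le_of_second_deriv_pos h1 h2 (by simp [h0]) (by linarith)] with x hx
  refine abs_le_of_sq_le_sq' ?_ (by positivity) |>.2
  rw [slope_sq hv0, mul_pow, sq_abs]
  simp [ha] at hx
  linarith

lemma mul_le_integral_of_le {f : ℝ → ℝ} (hf : Continuous f) (hf0 : ∀ x, 0 ≤ f x) {a b p q m : ℝ}
    (hap : a ≤ p) (hpq : p ≤ q) (hqb : q ≤ b) (hm : ∀ x ∈ Icc p q, m ≤ f x) :
    m * (q - p) ≤ ∫ x in a..b, f x := by
  have h1 : ∫ x in p..q, f x ≤ ∫ x in a..b, f x :=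
    intervalIntegral.integral_mono_interval hap hpq hqb
      (Eventually.of_forall hf0) (hf.intervalIntegrable _ _)
  have h2 : ∫ _ in p..q, m ≤ ∫ x in p..q, f x :=
    intervalIntegral.integral_mono_on hpq (by simp) (hf.intervalIntegrable _ _) hm
  simp only [intervalIntegral.integral_const, smul_eq_mul] at h2
  linarith

/-- The level drops below `1` by at most `d √|v''(a)| + o(d)`, for every maximum point `a`. -/
lemma eventually_one_sub_level_le (hv : ContDiff ℝ 2 v) (hper : Function.Periodic v 1)
    (hv0 : ∀ x, v x ≤ 0) (hμ : |μ| < ∫ y in (0:ℝ)..1, slope v y) {a κ : ℝ} (ha : v a = 0)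
    (hκ : √|deriv (deriv v) a| < κ) :
    ∀ᶠ d in 𝓝[>] (0:ℝ), ∀ H u, IsProfile v μ d H u → 1 - H ≤ d * κ := by
  -- The line of slope `κ₁` dominates the slope near `a`, the line of slope `κ₂` is the one tested
  -- for crossings, and `κ₂ - κ₁` yields the `L¹` defect `m`.
  obtain ⟨κ₂, h2, h3⟩ := exists_between hκ
  obtain ⟨κ₁, h1, h2⟩ := exists_between h2
  have hκ₁ : 0 < κ₁ := lt_of_le_of_lt (Real.sqrt_nonneg _) h1
  have h1' : |deriv (deriv v) a| < κ₁ ^ 2 := (Real.sqrt_lt' hκ₁).1 h1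
  obtain ⟨ρ, hρ, hρs⟩ := Metric.eventually_nhds_iff.1 (eventually_slope_le hv hv0 ha hκ₁.le h1')
  set r := min (ρ / 2) (1 / 2) with hr
  have hr0 : 0 < r := by positivity
  have hr1 : r ≤ 1 / 2 := min_le_right _ _
  have hr2 : r ≤ ρ / 2 := min_le_left _ _
  have hs : ∀ x, |x - a| ≤ r → slope v x ≤ κ₁ * |x - a| := fun x hx =>
    hρs (by rw [Real.dist_eq]; linarith)
  set m := (κ₂ - κ₁) * (r / 2) with hm
  have hm0 : 0 < m := mul_pos (by linarith) (by linarith)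
  have hv1 : ContDiff ℝ 1 v := hv.of_le (by norm_num)
  filter_upwards [self_mem_nhdsWithin, eventually_integral_abs_sub_le hv1 hper hv0 ha hμ
    (a - 1 / 2) (show 0 < m * (r / 2) / 2 by positivity)] with d hd hint H u hu
  have hd : 0 < d := hd
  have hint := hint H u hu
  by_contra! hH
  have huc := hu.continuous
  have hsc := continuous_slope hv.continuous
  have hfc : Continuous (fun x => |(|u x| - slope v x)|) := by fun_prop
  have hmr : 0 < m * (r / 2) := by positivity
  have hgap : ∀ x, |x - a| ≤ r → r / 2 ≤ |x - a| → κ₂ * |x - a| ≤ |u x| →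
      m ≤ |(|u x| - slope v x)| := by
    intro x hx1 hx2 hx3
    refine le_trans ?_ (le_abs_self _)
    have := hs x hx1
    have : (κ₂ - κ₁) * (r / 2) ≤ (κ₂ - κ₁) * |x - a| :=
      mul_le_mul_of_nonneg_left hx2 (by linarith)
    linarith
  -- On the line `κ₂ (x - a)` one has `|u| ≥ slope`, so the residual is at least `1 - H > d κ` and
  -- `u' ≥ κ > κ₂`: only upward crossings. Either `u` is above the line somewhere on the left and
  -- hence throughout the right, or below it throughout the left interval; both contradict `L¹`
  -- convergence.
  by_cases hcase : ∃ p ∈ Icc (a - r) (a - r / 2), 0 ≤ u p - κ₂ * (p - a)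
  · obtain ⟨p, hp, hp0⟩ := hcase
    have hbar := nonneg_of_deriv_pos_of_eq_zero (f := fun x => u x - κ₂ * (x - a)) (a := p)
      (b := a + r)
      (fun x _ => ((hu.hasDerivAt x).sub
        (((hasDerivAt_id x).sub_const a).const_mul κ₂)).hasDerivWithinAt)
      (fun x hx hx0 => ?_) hp0
    · have := mul_le_integral_of_le hfc (fun x => abs_nonneg _) (a := a - 1 / 2)
        (b := a - 1 / 2 + 1) (p := a + r / 2) (q := a + r) (m := m) (by linarith) (by linarith)
        (by linarith) (fun x hx => by
          have h4 := hbar x ⟨by linarith [hp.2, hx.1], hx.2⟩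
          have h5 : |x - a| = x - a := abs_of_nonneg (by linarith [hx.1])
          refine hgap x ?_ ?_ ?_ <;> rw [h5]
          · linarith [hx.2]
          · linarith [hx.1]
          · linarith [le_abs_self (u x)])
      rw [show a + r - (a + r / 2) = r / 2 by ring] at this
      linarith
    · have hux : u x = κ₂ * (x - a) := by linarith
      have h4 : slope v x ≤ |u x| := by
        refine (hs x (abs_le.2 ⟨by linarith [hp.1, hx.1], by linarith [hx.2]⟩)).trans ?_
        rw [hux, abs_mul, abs_of_pos (by linarith : 0 < κ₂)]
        gcongr
      have h5 := (le_sqrt_one_add_sq_iff_slope_le_abs hv0).2 h4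
      simp only [mul_one]
      have h6 : κ ≤ (1 + u x ^ 2) * (√(1 + u x ^ 2) + v x - H) / d := by
        rw [le_div_iff₀ hd]
        have h7 : d * κ ≤ √(1 + u x ^ 2) + v x - H := by linarith
        have h8 : 0 < d * κ := mul_pos hd (by linarith)
        nlinarith [sq_nonneg (u x)]
      linarith
  · push Not at hcase
    have := mul_le_integral_of_le hfc (fun x => abs_nonneg _) (a := a - 1 / 2)
      (b := a - 1 / 2 + 1) (p := a - r) (q := a - r / 2) (m := m) (by linarith) (by linarith)
      (by linarith) (fun x hx => by
        have h4 := hcase x hx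
        have h5 : |x - a| = -(x - a) := abs_of_nonpos (by linarith [hx.2])
        refine hgap x ?_ ?_ ?_ <;> rw [h5]
        · linarith [hx.1]
        · linarith [hx.2]
        · linarith [neg_le_abs (u x)])
    rw [show a - r / 2 - (a - r) = r / 2 by ring] at this
    linarith

end

/-! ### The barrier and the single sign change. -/

section
variable {v : ℝ → ℝ} {μ : ℝ}

/-- Near a maximum point the slope is above any line flatter than `√|v''|`. -/
lemma eventually_le_slope (hv : ContDiff ℝ 2 v) (hv0 : ∀ x, v x ≤ 0) {a κ : ℝ} (ha : v a = 0)
    (hκ : κ ^ 2 < |deriv (deriv v) a|) :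
    ∀ᶠ x in 𝓝 a, κ * |x - a| ≤ slope v x := by
  have hd := hasDerivAt_of_contDiff_two hv
  have hdd := hasDerivAt_deriv_of_contDiff_two hv a
  have h0 := deriv_eq_zero_of_max hv0 ha
  rw [abs_of_nonpos (second_deriv_nonpos_of_max hv hv0 ha)] at hκ
  have h1 : ∀ x, HasDerivAt (fun x => ((1 - v x) ^ 2 - 1) - κ ^ 2 * (x - a) ^ 2)
      (-(2 * ((1 - v x) * deriv v x)) - κ ^ 2 * (2 * (x - a))) x := by
    intro x
    refine (((((hd x).const_sub 1).pow 2).sub_const 1).sub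
      ((((hasDerivAt_id x).sub_const a).pow 2).const_mul (κ ^ 2))).congr_deriv ?_
    simp
    ring
  have h2 : HasDerivAt (fun x => -(2 * ((1 - v x) * deriv v x)) - κ ^ 2 * (2 * (x - a)))
      (2 * (-deriv (deriv v) a - κ ^ 2)) a := by
    refine (((((hd a).const_sub 1).mul hdd).const_mul 2).neg.sub
      ((((hasDerivAt_id a).sub_const a).const_mul 2).const_mul (κ ^ 2))).congr_deriv ?_
    simp [h0, ha]
    ring
  filter_upwards [eventually_le_of_second_deriv_pos h1 h2 (by simp [h0]) (by linarith)] with x hx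
  refine abs_le_of_sq_le_sq' ?_ (slope_nonneg x) |>.2
  rw [slope_sq hv0, mul_pow, sq_abs]
  simp [ha] at hx
  linarith

/-- A `C¹` function that vanishes with unit derivative at finitely many nondegenerate maxima. -/
lemma exists_contDiff_unit_deriv (hv : ContDiff ℝ 2 v) (hv0 : ∀ x, v x ≤ 0) {E : Set ℝ}
    (hE : E.Finite) (hE0 : ∀ e ∈ E, v e = 0) (hE2 : ∀ e ∈ E, deriv (deriv v) e ≠ 0) :
    ∃ φ : ℝ → ℝ, ContDiff ℝ 1 φ ∧ ∀ e ∈ E, φ e = 0 ∧ HasDerivAt φ 1 e := by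
  -- `v'` already vanishes at each maximum `e` with derivative `v''(e)`; a polynomial factor with
  -- value `1 / v''(e)` normalizes it.
  set P := Lagrange.interpolate hE.toFinset id (fun e => (deriv (deriv v) e)⁻¹) with hP
  refine ⟨fun x => deriv v x * P.eval x, ?_, fun e he => ?_⟩
  · have h1 : ContDiff ℝ 1 (deriv v) := by
      rw [show (2 : WithTop ℕ∞) = 1 + 1 by norm_num, contDiff_succ_iff_deriv] at hv
      exact hv.2.2
    have h2 : ContDiff ℝ 1 (fun x => P.eval x) := by
      simpa using P.contDiff_aeval (𝕜 := ℝ) 1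
    exact h1.mul h2
  · have h0 := deriv_eq_zero_of_max hv0 (hE0 e he)
    have hPe : P.eval e = (deriv (deriv v) e)⁻¹ :=
      Lagrange.eval_interpolate_at_node _ (injOn_id _) (hE.mem_toFinset.2 he)
    refine ⟨by simp [h0], ?_⟩
    refine ((hasDerivAt_deriv_of_contDiff_two hv e).mul (P.hasDerivAt e)).congr_deriv ?_
    rw [h0, hPe, zero_mul, add_zero, mul_inv_cancel₀ (hE2 e he)]

/-- The barrier: a function below the slope in modulus, which crosses zero with slope `κ` at
all maxima of `v` in `[p, q]`. -/
lemma exists_barrier (hv : ContDiff ℝ 2 v) (hv0 : ∀ x, v x ≤ 0) {p q κ : ℝ} (hκ0 : 0 < κ)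
    (hfin : {x ∈ Icc p q | v x = 0}.Finite)
    (hκ : ∀ e ∈ Icc p q, v e = 0 → κ < √|deriv (deriv v) e|) :
    ∃ ψ : ℝ → ℝ, ContDiff ℝ 1 ψ ∧ (∃ θ, 0 < θ ∧ θ < 1 ∧ ∀ x ∈ Icc p q, |ψ x| ≤ θ * slope v x) ∧
      ∀ e ∈ Icc p q, v e = 0 → deriv ψ e = κ := by
  have hsc := continuous_slope hv.continuous
  set E := {x ∈ Icc p q | v x = 0} with hE
  obtain ⟨φ, hφ, hφE⟩ := exists_contDiff_unit_deriv hv hv0 hfin (fun e he => he.2)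
    (fun e he h => by
      have := hκ e he.1 he.2
      simp [h] at this
      linarith)
  have hφc := hφ.continuous
  obtain ⟨κ₁, hκ₁E, hκ₁⟩ : ∃ κ₁, (∀ e ∈ E, κ₁ < √|deriv (deriv v) e|) ∧ κ < κ₁ := by
    have h1 : ∀ᶠ t in 𝓝[>] κ, ∀ e ∈ E, t < √|deriv (deriv v) e| :=
      (eventually_all_finite hfin).2 fun e he =>
        (eventually_lt_nhds (hκ e he.1 he.2)).filter_mono nhdsWithin_le_nhds
    exact (h1.and self_mem_nhdsWithin).exists
  obtain ⟨κ₂, hκ₂, hκ₂₁⟩ := exists_between hκ₁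
  have hκ₁0 : 0 < κ₁ := by linarith
  set θ := κ₂ / κ₁ with hθ
  have hθ0 : 0 < θ := div_pos (by linarith) hκ₁0
  have hθ1 : θ < 1 := (div_lt_one hκ₁0).2 hκ₂₁
  -- Near a maximum `φ` is almost `x - e`, so `κ |φ| ≤ κ₂ |x - e| = θ κ₁ |x - e| ≤ θ slope`. Only
  -- points away from the maxima need damping, and there the slope is bounded below.
  set O := interior {x | κ * |φ x| ≤ θ * slope v x} with hO
  have hEO : ∀ e ∈ E, e ∈ O := by
    intro e he
    obtain ⟨hφe, hφ'⟩ := hφE e he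
    rw [mem_interior_iff_mem_nhds]
    have h1 : κ₁ ^ 2 < |deriv (deriv v) e| := (Real.lt_sqrt hκ₁0.le).1 (hκ₁E e he)
    have h2 := (hasDerivAt_iff_isLittleO.1 hφ').def (c := (κ₂ - κ) / κ)
      (div_pos (by linarith) hκ0)
    filter_upwards [eventually_le_slope hv hv0 he.2 h1, h2] with x hx1 hx2
    rw [hφe, sub_zero, smul_eq_mul, mul_one, Real.norm_eq_abs, Real.norm_eq_abs,
      div_mul_eq_mul_div, le_div_iff₀ hκ0] at hx2
    have h3 : |φ x| ≤ |φ x - (x - e)| + |x - e| := by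
      have := abs_add_le (φ x - (x - e)) (x - e)
      rwa [sub_add_cancel] at this
    have h4 : κ * |φ x| ≤ κ₂ * |x - e| := by nlinarith
    have h5 : κ₂ * |x - e| = θ * (κ₁ * |x - e|) := by rw [hθ]; field_simp
    have h6 : θ * (κ₁ * |x - e|) ≤ θ * slope v x := by gcongr
    change κ * |φ x| ≤ θ * slope v x
    linarith
  obtain ⟨m, hm0, hm⟩ : ∃ m, 0 < m ∧ ∀ x ∈ Icc p q \ O, m ≤ slope v x := by
    have hc : IsCompact (Icc p q \ O) := isCompact_Icc.diff isOpen_interior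
    refine hc.exists_forall_le' (a := 0) hsc.continuousOn (fun x hx => ?_)
    refine lt_of_le_of_ne (slope_nonneg x) (fun h => hx.2 (hEO x ⟨hx.1, ?_⟩))
    exact (slope_eq_zero_iff hv0).1 h.symm
  -- Dividing `κ φ` by `1 + (n φ)²` caps it at `κ / n = θ m`; the denominator is `1` with zero
  -- derivative at each `e`, so the derivative `κ` survives.
  set n := κ / (θ * m) with hn
  have hn0 : 0 < n := by positivity
  have hden : ∀ x, 0 < 1 + (n * φ x) ^ 2 := fun x => by positivity
  refine ⟨fun x => κ * φ x / (1 + (n * φ x) ^ 2), ?_, ⟨θ, hθ0, hθ1, fun x hx => ?_⟩,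
    fun e he hve => ?_⟩
  · exact (contDiff_const.mul hφ).div (contDiff_const.add ((contDiff_const.mul hφ).pow 2))
      (fun x => (hden x).ne')
  · rw [abs_div, abs_of_pos (hden x), abs_mul, abs_of_pos hκ0]
    by_cases hxO : x ∈ O
    · have h1 : x ∈ {x | κ * |φ x| ≤ θ * slope v x} := interior_subset hxO
      change κ * |φ x| ≤ θ * slope v x at h1
      refine le_trans (div_le_self (by positivity) ?_) h1
      linarith [sq_nonneg (n * φ x)]
    · have h1 := hm x ⟨hx, hxO⟩
      refine le_trans ?_ (mul_le_mul_of_nonneg_left h1 hθ0.le)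
      rw [div_le_iff₀ (hden x)]
      have h2 : κ = n * (θ * m) := by rw [hn]; field_simp
      have h3 : n * |φ x| ≤ 1 + (n * φ x) ^ 2 := by
        rw [mul_pow, ← sq_abs (φ x), ← mul_pow]
        nlinarith [sq_nonneg (n * |φ x| - 1)]
      have h4 : (θ * m) * (n * |φ x|) ≤ (θ * m) * (1 + (n * φ x) ^ 2) := by gcongr
      calc κ * |φ x| = (θ * m) * (n * |φ x|) := by rw [h2]; ring
        _ ≤ _ := h4
  · obtain ⟨hφe, hφ'⟩ := hφE e ⟨he, hve⟩
    refine (((hφ'.const_mul κ).div (((hφ'.const_mul n).pow 2).const_add 1)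
      (hden e).ne').congr_deriv ?_).deriv
    simp [hφe]

/-- For small `d` the profile crosses the barrier only downwards. -/
lemma eventually_deriv_lt_barrier (hv : Continuous v) (hv0 : ∀ x, v x ≤ 0) {p q κ κ' θ : ℝ}
    (hκ : κ' < κ) {ψ : ℝ → ℝ} (hψ : ContDiff ℝ 1 ψ) (hθ1 : θ < 1)
    (hψs : ∀ x ∈ Icc p q, |ψ x| ≤ θ * slope v x)
    (hψ' : ∀ e ∈ Icc p q, v e = 0 → deriv ψ e = κ) :
    ∀ᶠ d in 𝓝[>] (0:ℝ), ∀ H, 1 - H ≤ d * κ' → ∀ x ∈ Icc p q,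
      (1 + ψ x ^ 2) * (√(1 + ψ x ^ 2) + v x - H) / d < deriv ψ x := by
  have hψc := hψ.continuous
  have hψ'c : Continuous (deriv ψ) := hψ.continuous_deriv le_rfl
  have hψs' : ∀ x ∈ Icc p q, |ψ x| ≤ slope v x := fun x hx =>
    (hψs x hx).trans (mul_le_of_le_one_left (slope_nonneg x) hθ1.le)
  -- Off `K` the bound `1 - H ≤ d κ'` suffices. `K` contains no maximum of `v`, because `ψ' = κ >
  -- κ'` there; by compactness the residual of `ψ` at level `1` is at most `-c` on `K`, which wins
  -- for small `d`.
  set K := Icc p q ∩ {x | deriv ψ x ≤ κ' * (1 + ψ x ^ 2)} with hK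
  have hKc : IsCompact K := isCompact_Icc.inter_right (isClosed_le hψ'c (by fun_prop))
  obtain ⟨c, hc0, hc⟩ : ∃ c, 0 < c ∧ ∀ x ∈ K, c ≤ 1 - v x - √(1 + ψ x ^ 2) := by
    refine hKc.exists_forall_le' (a := 0) (by fun_prop) (fun x hx => ?_)
    have h1 : slope v x ≠ 0 := by
      intro h
      have h2 := hψs' x hx.1
      rw [h] at h2
      have h3 : ψ x = 0 := abs_eq_zero.1 (le_antisymm h2 (abs_nonneg _))
      have h4 : deriv ψ x ≤ κ' * (1 + ψ x ^ 2) := hx.2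
      rw [hψ' x hx.1 ((slope_eq_zero_iff hv0).1 h), h3] at h4
      norm_num at h4
      linarith
    have h2 : 0 < slope v x := lt_of_le_of_ne (slope_nonneg x) h1.symm
    have h3 : |ψ x| < slope v x := lt_of_le_of_lt (hψs x hx.1) (by nlinarith)
    by_contra! h4
    have := (le_sqrt_one_add_sq_iff_slope_le_abs hv0 (a := ψ x) (x := x)).1 (by linarith)
    linarith
  obtain ⟨C, hC⟩ := isCompact_Icc.exists_bound_of_continuousOn (s := Icc p q)
    (f := fun x => κ' * (1 + ψ x ^ 2) - deriv ψ x) (by fun_prop)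
  filter_upwards [self_mem_nhdsWithin, eventually_mul_lt C hc0] with d hd hsmall H hH x hx
  have hd : 0 < d := hd
  rw [div_lt_iff₀ hd]
  have h1 := (sqrt_one_add_sq_le_iff_abs_le_slope hv0).2 (hψs' x hx)
  have h2 : (1 + ψ x ^ 2) * (1 - H) ≤ (1 + ψ x ^ 2) * (d * κ') := by gcongr
  have h3 := sq_nonneg (ψ x)
  by_cases hxK : x ∈ K
  · have h4 := hc x hxK
    have h5 := (le_abs_self _).trans (hC x hx)
    have h6 : (1 + ψ x ^ 2) * (√(1 + ψ x ^ 2) + v x - 1) ≤ -c := by nlinarith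
    have h7 : d * (κ' * (1 + ψ x ^ 2) - deriv ψ x) ≤ d * C := by gcongr
    linarith
  · have h4 : κ' * (1 + ψ x ^ 2) < deriv ψ x := by
      by_contra! h
      exact hxK ⟨hx, h⟩
    have h6 : (1 + ψ x ^ 2) * (√(1 + ψ x ^ 2) + v x - 1) ≤ 0 :=
      mul_nonpos_of_nonneg_of_nonpos (by linarith) (by linarith)
    have h7 : d * (κ' * (1 + ψ x ^ 2)) < d * deriv ψ x := by gcongr
    linarith

lemma exists_crossing {f f' : ℝ → ℝ} {p q : ℝ} (hpq : p ≤ q)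
    (hf : ∀ x ∈ Icc p q, HasDerivAt f (f' x) x) (hneg : ∀ x ∈ Icc p q, f x = 0 → f' x < 0) :
    ∃ z ∈ Icc p q, ∀ x ∈ Icc p q, (x < z → 0 ≤ f x) ∧ (z < x → f x ≤ 0) := by
  -- Adding `q` gives `z = q` when `f` stays positive. Once nonpositive, `f` remains so.
  set A := {x ∈ Icc p q | f x ≤ 0} ∪ {q} with hA
  have hqA : q ∈ A := Or.inr rfl
  have hpA : ∀ x ∈ A, p ≤ x := by
    rintro x (hx | hx)
    · exact hx.1.1
    · rw [mem_singleton_iff.1 hx]; exact hpq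
  have hbdd : BddBelow A := ⟨p, hpA⟩
  refine ⟨sInf A, ⟨le_csInf ⟨q, hqA⟩ hpA, csInf_le hbdd hqA⟩, fun x hx => ⟨fun h => ?_, fun h => ?_⟩⟩
  · by_contra! h1
    exact absurd (csInf_le hbdd (Or.inl ⟨hx, h1.le⟩)) (not_le.2 h)
  · obtain ⟨y, hyA, hyx⟩ := exists_lt_of_csInf_lt ⟨q, hqA⟩ h
    rcases hyA with hy | hy
    · exact nonpos_of_deriv_neg_of_eq_zero (a := y) (b := x)
        (fun t ht => (hf t ⟨hy.1.1.trans ht.1, ht.2.trans hx.2⟩).hasDerivWithinAt)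
        (fun t ht => hneg t ⟨hy.1.1.trans ht.1, ht.2.trans hx.2⟩) hy.2 x ⟨hyx.le, le_rfl⟩
    · rw [mem_singleton_iff.1 hy] at hyx
      exact absurd hx.2 (not_le.2 hyx)

/-- Closeness of `|a|` to `s` becomes closeness of `a` to `s`: a negative `a` above the barrier has
`|a| ≤ θ s`, so `|a|` misses `s` by at least `(1 - θ) s`, while `|a - s| ≤ (1 + θ) s`. -/
lemma abs_sub_le_of_barrier {a b s θ : ℝ} (hs : 0 ≤ s) (hθ0 : 0 < θ) (hθ1 : θ < 1)
    (hb : |b| ≤ θ * s) (hab : b ≤ a) : |a - s| ≤ (1 + θ) / (1 - θ) * |(|a| - s)| := by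
  have h1 : 1 ≤ (1 + θ) / (1 - θ) := by rw [le_div_iff₀] <;> linarith
  rcases le_or_gt 0 a with h | h
  · rw [abs_of_nonneg h]
    exact le_mul_of_one_le_left (abs_nonneg _) h1
  · have h2 : |a| ≤ θ * s := by
      rw [abs_of_neg h]
      linarith [neg_abs_le b]
    rw [abs_of_neg h] at h2 ⊢
    have h3 : θ * s ≤ s := mul_le_of_le_one_left hs hθ1.le
    rw [abs_of_nonpos (by linarith), abs_of_nonpos (by linarith), div_mul_eq_mul_div,
      le_div_iff₀ (by linarith)]
    nlinarith

lemma abs_add_le_of_barrier {a b s θ : ℝ} (hs : 0 ≤ s) (hθ0 : 0 < θ) (hθ1 : θ < 1)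
    (hb : |b| ≤ θ * s) (hab : a ≤ b) : |a + s| ≤ (1 + θ) / (1 - θ) * |(|a| - s)| := by
  have := abs_sub_le_of_barrier (a := -a) (b := -b) hs hθ0 hθ1 (by rwa [abs_neg]) (by linarith)
  rwa [abs_neg, ← abs_neg, neg_sub, sub_neg_eq_add, add_comm] at this

end

/-! ### Uniform convergence of the primitives. -/

section
variable {v : ℝ → ℝ} {μ : ℝ}

/-- The barrier does not reach the ends of the cell; the end strips are paid for by a sup bound,
here on the left and below on the right. -/
lemma integral_abs_le_of_le_left {f g : ℝ → ℝ} (hf : Continuous f) (hg : Continuous g)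
    {a p z C M : ℝ} (hap : a ≤ p) (hpz : p ≤ z) (hM : ∀ x, |f x| ≤ M)
    (hC : ∀ x ∈ Ioo p z, |f x| ≤ C * g x) :
    ∫ x in a..z, |f x| ≤ M * (p - a) + C * ∫ x in p..z, g x := by
  rw [← intervalIntegral.integral_add_adjacent_intervals (hf.abs.intervalIntegrable a p)
    (hf.abs.intervalIntegrable p z), ← intervalIntegral.integral_const_mul]
  refine add_le_add ?_ ?_
  · have := intervalIntegral.integral_mono (μ := MeasureTheory.volume) hap
      (hf.abs.intervalIntegrable a p) (continuous_const (y := M) |>.intervalIntegrable a p) hM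
    simp only [intervalIntegral.integral_const, smul_eq_mul] at this
    linarith
  · exact intervalIntegral.integral_mono_on_of_le_Ioo hpz (hf.abs.intervalIntegrable p z)
      ((continuous_const.mul hg).intervalIntegrable p z) hC

lemma integral_abs_le_of_le_right {f g : ℝ → ℝ} (hf : Continuous f) (hg : Continuous g)
    {z q b C M : ℝ} (hzq : z ≤ q) (hqb : q ≤ b) (hM : ∀ x, |f x| ≤ M)
    (hC : ∀ x ∈ Ioo z q, |f x| ≤ C * g x) :
    ∫ x in z..b, |f x| ≤ C * (∫ x in z..q, g x) + M * (b - q) := by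
  rw [← intervalIntegral.integral_add_adjacent_intervals (hf.abs.intervalIntegrable z q)
    (hf.abs.intervalIntegrable q b), ← intervalIntegral.integral_const_mul]
  refine add_le_add ?_ ?_
  · exact intervalIntegral.integral_mono_on_of_le_Ioo hzq (hf.abs.intervalIntegrable z q)
      ((continuous_const.mul hg).intervalIntegrable z q) hC
  · have := intervalIntegral.integral_mono (μ := MeasureTheory.volume) hqb
      (hf.abs.intervalIntegrable q b) (continuous_const (y := M) |>.intervalIntegrable q b) hM
    simp only [intervalIntegral.integral_const, smul_eq_mul] at this
    linarith

lemma integral_slope_mono (hv : Continuous v) (a : ℝ) :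
    Monotone (fun x => ∫ y in a..x, slope v y) := by
  have hsc := continuous_slope hv
  intro x y hxy
  have h1 := intervalIntegral.integral_add_adjacent_intervals (hsc.intervalIntegrable
    (μ := MeasureTheory.volume) a x) (hsc.intervalIntegrable x y)
  have h2 : 0 ≤ ∫ t in x..y, slope v t :=
    intervalIntegral.integral_nonneg hxy (fun t _ => slope_nonneg t)
  simp only
  linarith

/-- A function that is close in `L¹` to the slope up to `z` and to minus the slope after `z`
has a primitive close to the two-branch primitive of the slope. -/
lemma abs_integral_sub_min_le (hv : Continuous v) {u : ℝ → ℝ} (hu : Continuous u) {a z b ε : ℝ}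
    (haz : a ≤ z) (hzb : z ≤ b)
    (h : (∫ x in a..z, |u x - slope v x|) + ∫ x in z..b, |u x + slope v x| ≤ ε)
    {x : ℝ} (hx : x ∈ Icc a b) :
    |(∫ y in a..x, u y) - min (∫ y in a..x, slope v y)
      (2 * (∫ y in a..z, slope v y) - ∫ y in a..x, slope v y)| ≤ ε := by
  have hsc := continuous_slope hv
  have hm := integral_slope_mono hv a
  have hi : ∀ p q, IntervalIntegrable (slope v) MeasureTheory.volume p q :=
    fun p q => hsc.intervalIntegrable p q
  have hiu : ∀ p q, IntervalIntegrable u MeasureTheory.volume p q :=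
    fun p q => hu.intervalIntegrable p q
  have hminus : Continuous (fun x => |u x - slope v x|) := by fun_prop
  have hplus : Continuous (fun x => |u x + slope v x|) := by fun_prop
  have n2 : 0 ≤ ∫ x in z..b, |u x + slope v x| :=
    intervalIntegral.integral_nonneg hzb (fun t _ => abs_nonneg _)
  rcases le_total x z with hxz | hzx
  · have h1 : (∫ y in a..x, slope v y) ≤ ∫ y in a..z, slope v y := hm hxz
    rw [min_eq_left (by linarith), ← intervalIntegral.integral_sub (hiu _ _) (hi _ _)]
    refine (intervalIntegral.abs_integral_le_integral_abs hx.1).trans ?_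
    have h2 : ∫ x in a..x, |u x - slope v x| ≤ ∫ x in a..z, |u x - slope v x| :=
      intervalIntegral.integral_mono_interval le_rfl hx.1 hxz
        (Eventually.of_forall fun t => abs_nonneg _) (hminus.intervalIntegrable _ _)
    linarith
  · have h1 : (∫ y in a..z, slope v y) ≤ ∫ y in a..x, slope v y := hm hzx
    have e1 := intervalIntegral.integral_add_adjacent_intervals (hi a z) (hi z x)
    have e2 := intervalIntegral.integral_add_adjacent_intervals (hiu a z) (hiu z x)
    rw [min_eq_right (by linarith)]
    have e3 : (∫ y in a..x, u y) - (2 * (∫ y in a..z, slope v y) - ∫ y in a..x, slope v y) =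
        (∫ y in a..z, (u y - slope v y)) + ∫ y in z..x, (u y + slope v y) := by
      rw [intervalIntegral.integral_sub (hiu _ _) (hi _ _),
        intervalIntegral.integral_add (hiu _ _) (hi _ _)]
      linarith
    rw [e3]
    refine (abs_add_le _ _).trans ?_
    have h2 := intervalIntegral.abs_integral_le_integral_abs (μ := MeasureTheory.volume)
      (f := fun y => u y - slope v y) haz
    have h3 := intervalIntegral.abs_integral_le_integral_abs (μ := MeasureTheory.volume)
      (f := fun y => u y + slope v y) hzx
    have h4 : ∫ x in z..x, |u x + slope v x| ≤ ∫ x in z..b, |u x + slope v x| :=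
      intervalIntegral.integral_mono_interval le_rfl hzx hx.2
        (Eventually.of_forall fun t => abs_nonneg _) (hplus.intervalIntegrable _ _)
    linarith

/-- As `d → 0⁺` the primitives of the profiles converge uniformly on the cell that starts at the
flattest maximum point `a`. -/
theorem eventually_abs_integral_sub_le (hv : ContDiff ℝ 2 v) (hper : Function.Periodic v 1)
    (hv0 : ∀ x, v x ≤ 0) (hμ : |μ| < ∫ y in (0:ℝ)..1, slope v y) {a : ℝ} (ha : v a = 0)
    (hfin : {x ∈ Icc a (a + 1) | v x = 0}.Finite)
    (hmin : ∀ e ∈ Ioo a (a + 1), v e = 0 → √|deriv (deriv v) a| < √|deriv (deriv v) e|)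
    {ε : ℝ} (hε : 0 < ε) :
    ∀ᶠ d in 𝓝[>] (0:ℝ), ∀ H u, IsProfile v μ d H u → ∀ x ∈ Icc a (a + 1),
      |(∫ y in a..x, u y) - min (∫ y in a..x, slope v y)
        (μ + (∫ y in a..(a + 1), slope v y) - ∫ y in a..x, slope v y)| ≤ ε := by
  have hvc := hv.continuous
  have hsc := continuous_slope hvc
  have hv1 : ContDiff ℝ 1 v := hv.of_le (by norm_num)
  -- Finiteness of the zeros leaves room for one `κ` strictly between `√|v''(a)|` and the values at
  -- all interior maxima.
  obtain ⟨κ, hκE, hκ⟩ : ∃ κ, (∀ e ∈ {x ∈ Icc a (a + 1) | v x = 0}, e ∈ Ioo a (a + 1) →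
      κ < √|deriv (deriv v) e|) ∧ √|deriv (deriv v) a| < κ := by
    have h1 : ∀ᶠ t in 𝓝[>] √|deriv (deriv v) a|, ∀ e ∈ {x ∈ Icc a (a + 1) | v x = 0},
        e ∈ Ioo a (a + 1) → t < √|deriv (deriv v) e| := by
      refine (eventually_all_finite hfin).2 fun e he => ?_
      by_cases he' : e ∈ Ioo a (a + 1)
      · filter_upwards [(eventually_lt_nhds (hmin e he' he.2)).filter_mono nhdsWithin_le_nhds]
          with t ht _ using ht
      · exact Eventually.of_forall fun t h => absurd h he'
    exact (h1.and self_mem_nhdsWithin).exists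
  obtain ⟨κ', hκ', hκκ'⟩ := exists_between hκ
  have hκ0 : 0 < κ := lt_of_le_of_lt (Real.sqrt_nonneg _) hκ
  obtain ⟨B, V, E, hB, hV, hE, hVv, hest⟩ := exists_uniform_bounds hv1 hper hv0 μ
  obtain ⟨x₁, hx₁⟩ := exists_forall_le_of_periodic hsc (periodic_slope hper)
  set M := B + slope v x₁ with hM
  have hM0 : 0 ≤ M := add_nonneg hB (slope_nonneg _)
  obtain ⟨δ, hδ0, hδ1, hδM⟩ : ∃ δ : ℝ, 0 < δ ∧ δ ≤ 1 / 4 ∧ M * δ ≤ ε / 8 := by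
    refine ⟨min (1 / 4) (ε / (8 * (M + 1))), by positivity, min_le_left _ _, ?_⟩
    have h1 : min (1 / 4) (ε / (8 * (M + 1))) ≤ ε / (8 * (M + 1)) := min_le_right _ _
    calc M * min (1 / 4) (ε / (8 * (M + 1))) ≤ (M + 1) * (ε / (8 * (M + 1))) := by
          gcongr; linarith
      _ = ε / 8 := by field_simp
  have hsub : Icc (a + δ) (a + 1 - δ) ⊆ Ioo a (a + 1) := fun x hx =>
    ⟨by linarith [hx.1], by linarith [hx.2]⟩
  obtain ⟨ψ, hψ, ⟨θ, hθ0, hθ1, hψs⟩, hψ'⟩ := exists_barrier hv hv0 (p := a + δ)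
    (q := a + 1 - δ) hκ0
    (hfin.subset fun x hx => ⟨Ioo_subset_Icc_self (hsub hx.1), hx.2⟩)
    (fun e he hve => hκE e ⟨Ioo_subset_Icc_self (hsub he), hve⟩ (hsub he))
  set C := (1 + θ) / (1 - θ) with hC
  have hC0 : 0 < C := div_pos (by linarith) (by linarith)
  filter_upwards [self_mem_nhdsWithin, eventually_one_sub_level_le hv hper hv0 hμ ha hκ',
    eventually_deriv_lt_barrier hvc hv0 hκκ' hψ hθ1 hψs hψ',
    eventually_integral_abs_sub_le hv1 hper hv0 ha hμ a (show 0 < ε / (4 * C) by positivity)]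
    with d hd hlev hbar hint H u hu
  have hd : 0 < d := hd
  have hlev := hlev H u hu
  have hint := hint H u hu
  have hub := (hest d hd H u hu).1
  have huc := hu.continuous
  obtain ⟨z, hz, hzx⟩ := exists_crossing (f := fun x => u x - ψ x) (p := a + δ) (q := a + 1 - δ)
    (by linarith)
    (fun x _ => (hu.hasDerivAt x).sub ((hψ.differentiable (by norm_num)) x).hasDerivAt)
    (fun x hx h => by
      have h1 : u x = ψ x := by linarith
      have := hbar H hlev x hx
      rw [h1]
      linarith)
  have hgc : Continuous (fun x => |(|u x| - slope v x)|) := by fun_prop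
  have hMm : ∀ x, |u x - slope v x| ≤ M := fun x => by
    refine (abs_sub _ _).trans ?_
    rw [abs_of_nonneg (slope_nonneg x)]
    exact add_le_add (hub x) (hx₁ x)
  have hMp : ∀ x, |u x + slope v x| ≤ M := fun x => by
    refine (abs_add_le _ _).trans ?_
    rw [abs_of_nonneg (slope_nonneg x)]
    exact add_le_add (hub x) (hx₁ x)
  have h1 := integral_abs_le_of_le_left (f := fun x => u x - slope v x) (huc.sub hsc) hgc
    (a := a) (p := a + δ) (z := z) (C := C) (M := M) (by linarith) hz.1 hMm (fun x hx => by
      have hx' : x ∈ Icc (a + δ) (a + 1 - δ) := ⟨hx.1.le, hx.2.le.trans hz.2⟩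
      exact abs_sub_le_of_barrier (slope_nonneg x) hθ0 hθ1 (hψs x hx')
        (by have := (hzx x hx').1 hx.2; linarith))
  have h2 := integral_abs_le_of_le_right (f := fun x => u x + slope v x) (huc.add hsc) hgc
    (z := z) (q := a + 1 - δ) (b := a + 1) (C := C) (M := M) hz.2 (by linarith) hMp
    (fun x hx => by
      have hx' : x ∈ Icc (a + δ) (a + 1 - δ) := ⟨hz.1.trans hx.1.le, hx.2.le⟩
      exact abs_add_le_of_barrier (slope_nonneg x) hθ0 hθ1 (hψs x hx')
        (by have := (hzx x hx').2 hx.1; linarith))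
  have h3 : (∫ x in (a + δ)..z, |(|u x| - slope v x)|) +
      ∫ x in z..(a + 1 - δ), |(|u x| - slope v x)| ≤ ε / (4 * C) := by
    rw [intervalIntegral.integral_add_adjacent_intervals (hgc.intervalIntegrable _ _)
      (hgc.intervalIntegrable _ _)]
    refine le_trans ?_ hint
    exact intervalIntegral.integral_mono_interval (by linarith) (by linarith) (by linarith)
      (Eventually.of_forall fun t => abs_nonneg _) (hgc.intervalIntegrable _ _)
  have h4 : C * ((∫ x in (a + δ)..z, |(|u x| - slope v x)|) +
      ∫ x in z..(a + 1 - δ), |(|u x| - slope v x)|) ≤ C * (ε / (4 * C)) := by gcongr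
  have h5 : C * (ε / (4 * C)) = ε / 4 := by field_simp
  -- The two end strips cost `ε / 8` each and the interior `ε / 4`.
  have h6 : (∫ x in a..z, |u x - slope v x|) + ∫ x in z..(a + 1), |u x + slope v x| ≤ ε / 2 := by
    rw [show a + δ - a = δ by ring] at h1
    rw [show a + 1 - (a + 1 - δ) = δ by ring] at h2
    linarith
  have haz : a ≤ z := by linarith [hz.1]
  have hzb : z ≤ a + 1 := by linarith [hz.2]
  have hkey := fun x hx => abs_integral_sub_min_le hvc huc haz hzb h6 (x := x) hx
  set S := fun x => ∫ y in a..x, slope v y with hS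
  have hSm : Monotone S := integral_slope_mono hvc a
  -- The point `z` depends on `d` and need not be located: over the full cell `u` integrates to `μ`,
  -- which determines `S z` up to an error. This uses the other `ε / 2`.
  have hSz : |2 * S z - (μ + S (a + 1))| ≤ ε / 2 := by
    have h7 := hkey (a + 1) ⟨by linarith, le_rfl⟩
    have h8 := hu.periodic.intervalIntegral_add_eq a 0
    rw [zero_add, hu.mean] at h8
    have h9 : S z ≤ S (a + 1) := hSm hzb
    change |_ - min (S (a + 1)) (2 * S z - S (a + 1))| ≤ ε / 2 at h7
    rw [h8, min_eq_right (by linarith), abs_sub_comm] at h7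
    rwa [show 2 * S z - (μ + S (a + 1)) = 2 * S z - S (a + 1) - μ by ring]
  intro x hx
  have h7 := hkey x hx
  change |_ - min (S x) (2 * S z - S x)| ≤ ε / 2 at h7
  change |_ - min (S x) (μ + S (a + 1) - S x)| ≤ ε
  have h8 : |min (S x) (2 * S z - S x) - min (S x) (μ + S (a + 1) - S x)| ≤ ε / 2 := by
    refine (abs_min_sub_min_le_max _ _ _ _).trans (max_le (by simp; positivity) ?_)
    rwa [show 2 * S z - S x - (μ + S (a + 1) - S x) = 2 * S z - (μ + S (a + 1)) by ring]
  have h9 := abs_sub_le (∫ y in a..x, u y) (min (S x) (2 * S z - S x))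
    (min (S x) (μ + S (a + 1) - S x))
  linarith

end

/-! ### The limit function and its viscosity property. -/

lemma nonneg_of_eventually_le_right {f : ℝ → ℝ} {c y : ℝ} (hf : HasDerivAt f c y)
    (h : ∀ᶠ x in 𝓝[>] y, f y ≤ f x) : 0 ≤ c := by
  have h1 : Tendsto (_root_.slope f y) (𝓝[>] y) (𝓝 c) :=
    (hasDerivWithinAt_iff_tendsto_slope' (by simp)).1 hf.hasDerivWithinAt
  refine ge_of_tendsto h1 ?_
  filter_upwards [h, self_mem_nhdsWithin] with x hx hxy
  have hxy : y < x := hxy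
  rw [slope_def_field]
  exact div_nonneg (by linarith) (by linarith)

lemma nonpos_of_eventually_le_left {f : ℝ → ℝ} {c y : ℝ} (hf : HasDerivAt f c y)
    (h : ∀ᶠ x in 𝓝[<] y, f y ≤ f x) : c ≤ 0 := by
  have h1 : Tendsto (_root_.slope f y) (𝓝[<] y) (𝓝 c) :=
    (hasDerivWithinAt_iff_tendsto_slope' (by simp)).1 hf.hasDerivWithinAt
  refine le_of_tendsto h1 ?_
  filter_upwards [h, self_mem_nhdsWithin] with x hx hxy
  have hxy : x < y := hxy
  rw [slope_def_field]
  exact div_nonpos_of_nonneg_of_nonpos (by linarith) (by linarith)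

/-- Carries increment estimates from one cell to the whole line, for functions that are periodic up
to a linear term. -/
lemma monotone_of_monotoneOn_cell {f : ℝ → ℝ} {a c : ℝ} (hc : 0 ≤ c)
    (hf : ∀ (x : ℝ) (n : ℤ), f (x + n) = f x + n * c) (hm : MonotoneOn f (Icc a (a + 1))) :
    Monotone f := by
  intro x y hxy
  obtain ⟨m, hmx, -⟩ := existsUnique_sub_zsmul_mem_Ico (zero_lt_one' ℝ) x a
  obtain ⟨n, hny, -⟩ := existsUnique_sub_zsmul_mem_Ico (zero_lt_one' ℝ) y a
  simp only [zsmul_eq_mul, mul_one] at hmx hny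
  have ex := hf (x - m) m
  have ey := hf (y - n) n
  rw [sub_add_cancel] at ex ey
  have hmn : m ≤ n := by
    have : (m : ℝ) < n + 1 := by linarith [hmx.1, hny.2]
    exact Int.lt_add_one_iff.1 (by exact_mod_cast this)
  rcases eq_or_lt_of_le hmn with rfl | hlt
  · have := hm (Ico_subset_Icc_self hmx) (Ico_subset_Icc_self hny) (by linarith)
    linarith
  · have h1 := hm (Ico_subset_Icc_self hmx) (right_mem_Icc.2 (by linarith)) hmx.2.le
    have h2 := hm (left_mem_Icc.2 (by linarith)) (Ico_subset_Icc_self hny) hny.1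
    have h3 := hf a 1
    have h4 : ((m : ℝ) + 1) ≤ n := by exact_mod_cast hlt
    have h5 : ((m : ℝ) + 1) * c ≤ n * c := by gcongr
    simp only [Int.cast_one, one_mul] at h3
    linarith

section
variable {v : ℝ → ℝ} {μ a z : ℝ}

lemma IsBalanced.two_mul (hv : Continuous v) (h : IsBalanced v μ a z) :
    2 * (∫ y in a..z, slope v y) = μ + ∫ y in a..(a + 1), slope v y := by
  have hsc := continuous_slope hv
  have e1 := intervalIntegral.integral_add_adjacent_intervals
    (hsc.intervalIntegrable (μ := MeasureTheory.volume) a z) (hsc.intervalIntegrable z (a + 1))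
  unfold IsBalanced at h
  linarith

lemma isBalanced_of_two_mul (hv : Continuous v)
    (h : 2 * (∫ y in a..z, slope v y) = μ + ∫ y in a..(a + 1), slope v y) :
    IsBalanced v μ a z := by
  have hsc := continuous_slope hv
  have e1 := intervalIntegral.integral_add_adjacent_intervals
    (hsc.intervalIntegrable (μ := MeasureTheory.volume) a z) (hsc.intervalIntegrable z (a + 1))
  unfold IsBalanced
  linarith

/-- The primitive of the slope is monotone, so the branch in force is always the smaller one. -/
lemma cellProfile_eq_min (hv : Continuous v) (x : ℝ) : cellProfile v μ a z x =
    min (∫ y in a..x, slope v y) (2 * (∫ y in a..z, slope v y) - ∫ y in a..x, slope v y)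
      - μ * x := by
  have hsc := continuous_slope hv
  have hm := integral_slope_mono hv a
  unfold cellProfile
  split_ifs with h
  · have h1 : (∫ y in a..x, slope v y) ≤ ∫ y in a..z, slope v y := hm h
    rw [min_eq_left (by linarith)]
  · have h1 : (∫ y in a..z, slope v y) ≤ ∫ y in a..x, slope v y := hm (not_le.1 h).le
    have e1 := intervalIntegral.integral_add_adjacent_intervals
      (hsc.intervalIntegrable (μ := MeasureTheory.volume) a z) (hsc.intervalIntegrable z x)
    rw [min_eq_right (by linarith)]
    linarith

lemma physicalSolution_eq_cellProfile (hv : Continuous v) (hz : z ∈ Icc a (a + 1))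
    (hbal : IsBalanced v μ a z) {x : ℝ} (hx : x ∈ Icc a (a + 1)) :
    physicalSolution v μ a z x = cellProfile v μ a z x := by
  unfold physicalSolution
  rcases eq_or_lt_of_le hx.2 with h | h
  -- At the right end the periodic extension takes the value at `a`; the balance condition makes the
  -- two agree.
  · have h1 : toIcoMod (zero_lt_one' ℝ) a x = a := by
      rw [h]; exact toIcoMod_apply_right _ _
    have h2 := hbal.two_mul hv
    have h3 : (∫ y in a..z, slope v y) ≤ ∫ y in a..(a + 1), slope v y :=
      integral_slope_mono hv a hz.2
    have h4 : (∫ y in a..a, slope v y) ≤ ∫ y in a..z, slope v y :=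
      integral_slope_mono hv a hz.1
    rw [intervalIntegral.integral_same] at h4
    rw [h1, h, cellProfile_eq_min hv, cellProfile_eq_min hv,
      min_eq_right (a := ∫ y in a..(a + 1), _) (by linarith),
      intervalIntegral.integral_same, min_eq_left (by linarith), h2]
    ring
  · rw [(toIcoMod_eq_self _).2 ⟨hx.1, h⟩]

lemma periodic_physicalSolution : Function.Periodic (physicalSolution v μ a z) 1 := fun x => by
  unfold physicalSolution
  rw [toIcoMod_add_right]

lemma integral_slope_add_int (hv : Continuous v) (hper : Function.Periodic v 1) (x : ℝ) (n : ℤ) :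
    ∫ y in a..(x + n), slope v y =
      (∫ y in a..x, slope v y) + n * ∫ y in a..(a + 1), slope v y := by
  have hsc := continuous_slope hv
  have e1 := intervalIntegral.integral_add_adjacent_intervals
    (hsc.intervalIntegrable (μ := MeasureTheory.volume) a x) (hsc.intervalIntegrable x (x + n))
  have e2 := (periodic_slope hper).intervalIntegral_add_zsmul_eq n x
    (fun p q => hsc.intervalIntegrable p q)
  have e3 := (periodic_slope hper).intervalIntegral_add_eq x a
  simp only [zsmul_eq_mul, mul_one] at e2
  rw [← e1, e2, e3]

/-- Translation of `w₀ + μ x`, the primitive of the signed slope. -/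
lemma physicalSolution_add_mul (x : ℝ) (n : ℤ) :
    physicalSolution v μ a z (x + n) + μ * (x + n) =
      (physicalSolution v μ a z x + μ * x) + n * μ := by
  have := (periodic_physicalSolution (v := v) (μ := μ) (a := a) (z := z)).int_mul n x
  rw [mul_one] at this
  rw [this]
  ring

lemma physicalSolution_add_mul_eq_min (hv : Continuous v) (hz : z ∈ Icc a (a + 1))
    (hbal : IsBalanced v μ a z) {x : ℝ} (hx : x ∈ Icc a (a + 1)) :
    physicalSolution v μ a z x + μ * x =
      min (∫ y in a..x, slope v y)
        (2 * (∫ y in a..z, slope v y) - ∫ y in a..x, slope v y) := by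
  rw [physicalSolution_eq_cellProfile hv hz hbal hx, cellProfile_eq_min hv]
  ring

/-- The increments of `w₀ + μ x` are controlled by the integral of the slope. -/
lemma abs_physicalSolution_sub_le (hv : Continuous v) (hper : Function.Periodic v 1)
    (hz : z ∈ Icc a (a + 1)) (hbal : IsBalanced v μ a z) {x y : ℝ} (hxy : x ≤ y) :
    |(physicalSolution v μ a z y + μ * y) - (physicalSolution v μ a z x + μ * x)| ≤
      (∫ t in a..y, slope v t) - ∫ t in a..x, slope v t := by
  have hm := integral_slope_mono hv a
  have h2 := hbal.two_mul hv
  have h3 : (∫ y in a..z, slope v y) ≤ ∫ y in a..(a + 1), slope v y := hm hz.2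
  have h4 : (∫ y in a..a, slope v y) ≤ ∫ y in a..z, slope v y := hm hz.1
  rw [intervalIntegral.integral_same] at h4
  have key : ∀ x ∈ Icc a (a + 1), ∀ y ∈ Icc a (a + 1), x ≤ y →
      |(physicalSolution v μ a z y + μ * y) - (physicalSolution v μ a z x + μ * x)| ≤
      (∫ t in a..y, slope v t) - ∫ t in a..x, slope v t := by
    intro x hx y hy hxy
    rw [physicalSolution_add_mul_eq_min hv hz hbal hx,
      physicalSolution_add_mul_eq_min hv hz hbal hy]
    have h5 : (∫ t in a..x, slope v t) ≤ ∫ t in a..y, slope v t := hm hxy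
    refine (abs_min_sub_min_le_max _ _ _ _).trans (max_le ?_ ?_)
    · rw [abs_of_nonneg (by linarith)]
    · rw [abs_of_nonpos (by linarith)]
      linarith
  -- The increment per period is nonnegative because balance and `a ≤ z ≤ a + 1` give `|μ| ≤ ∫
  -- slope` over the cell.
  have m1 : Monotone (fun x => (∫ t in a..x, slope v t) - (physicalSolution v μ a z x + μ * x)) :=
    monotone_of_monotoneOn_cell (a := a) (c := (∫ y in a..(a + 1), slope v y) - μ) (by linarith)
      (fun x n => by
        rw [integral_slope_add_int hv hper, physicalSolution_add_mul]
        ring)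
      (fun x hx y hy hxy => by
        have := (abs_le.1 (key x hx y hy hxy)).2
        linarith)
  have m2 : Monotone (fun x => (∫ t in a..x, slope v t) + (physicalSolution v μ a z x + μ * x)) :=
    monotone_of_monotoneOn_cell (a := a) (c := (∫ y in a..(a + 1), slope v y) + μ) (by linarith)
      (fun x n => by
        rw [integral_slope_add_int hv hper, physicalSolution_add_mul]
        ring)
      (fun x hx y hy hxy => by
        have := (abs_le.1 (key x hx y hy hxy)).1
        linarith)
  have h5 := m1 hxy
  have h6 := m2 hxy
  simp only at h5 h6
  rw [abs_le]
  constructor <;> linarith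

lemma continuous_integral_slope (hv : Continuous v) :
    Continuous (fun x => ∫ t in a..x, slope v t) :=
  intervalIntegral.continuous_primitive (fun p q => (continuous_slope hv).intervalIntegrable p q) a

lemma hasDerivAt_integral_slope (hv : Continuous v) (x : ℝ) :
    HasDerivAt (fun x => ∫ t in a..x, slope v t) (slope v x) x :=
  have hsc := continuous_slope hv
  intervalIntegral.integral_hasDerivAt_right (hsc.intervalIntegrable _ _)
    hsc.stronglyMeasurable.stronglyMeasurableAtFilter hsc.continuousAt

lemma continuous_physicalSolution (hv : Continuous v) (hper : Function.Periodic v 1)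
    (hz : z ∈ Icc a (a + 1)) (hbal : IsBalanced v μ a z) :
    Continuous (physicalSolution v μ a z) := by
  have hS := continuous_integral_slope (a := a) hv
  have h1 : Continuous (fun x => physicalSolution v μ a z x + μ * x) := by
    refine continuous_iff_continuousAt.2 fun y => ?_
    refine tendsto_iff_dist_tendsto_zero.2 (squeeze_zero (fun _ => dist_nonneg) (fun x => ?_)
      (tendsto_iff_dist_tendsto_zero.1 (hS.tendsto y)))
    rw [Real.dist_eq, Real.dist_eq]
    rcases le_total x y with h | h
    · rw [abs_sub_comm]
      refine (abs_physicalSolution_sub_le hv hper hz hbal h).trans ?_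
      rw [abs_sub_comm]
      exact le_abs_self _
    · exact (abs_physicalSolution_sub_le hv hper hz hbal h).trans (le_abs_self _)
  have h2 : physicalSolution v μ a z = fun x => (physicalSolution v μ a z x + μ * x) - μ * x := by
    ext x; ring
  rw [h2]
  fun_prop

/-- The subsolution test uses only the increment bound. For the supersolution test, translates of
`a` are trivial because the slope vanishes there; at any other point one branch is in force on at
least one side (left up to `z`, right from `z` on), which suffices for a one-sided derivative. -/
theorem isInviscidViscositySolution_physicalSolution (hv : Continuous v)
    (hper : Function.Periodic v 1) (hv0 : ∀ x, v x ≤ 0) (ha : v a = 0)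
    (hz : z ∈ Icc a (a + 1)) (hbal : IsBalanced v μ a z) :
    IsInviscidViscositySolution v μ 1 (physicalSolution v μ a z) := by
  have hS := fun y => hasDerivAt_integral_slope (v := v) (a := a) hv y
  have hdφ : ∀ φ : ℝ → ℝ, ContDiff ℝ 1 φ → ∀ y,
      HasDerivAt (fun x => φ x + μ * x) (deriv φ y + μ) y := fun φ hφ y =>
    ((((hφ.differentiable (by norm_num)) y).hasDerivAt).add
      ((hasDerivAt_id y).const_mul μ)).congr_deriv (by simp)
  refine ⟨continuous_physicalSolution hv hper hz hbal, fun φ y hφ hloc => ?_, fun φ y hφ hloc => ?_⟩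
  · have h1 : √(1 + (μ + deriv φ y) ^ 2) ≤ 1 - v y := by
      rw [sqrt_one_add_sq_le_iff_abs_le_slope hv0, abs_le]
      constructor
      · have := nonneg_of_eventually_le_right ((hdφ φ hφ y).add (hS y)) (by
          filter_upwards [hloc.filter_mono nhdsWithin_le_nhds, self_mem_nhdsWithin] with x hx hxy
          have := (abs_le.1 (abs_physicalSolution_sub_le hv hper hz hbal (le_of_lt hxy))).1
          simp only [Pi.add_apply]
          linarith)
        linarith
      · have := nonpos_of_eventually_le_left ((hdφ φ hφ y).sub (hS y)) (by
          filter_upwards [hloc.filter_mono nhdsWithin_le_nhds, self_mem_nhdsWithin] with x hx hxy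
          have := (abs_le.1 (abs_physicalSolution_sub_le hv hper hz hbal (le_of_lt hxy))).2
          simp only [Pi.sub_apply]
          linarith)
        linarith
    linarith
  · have h1 : 1 - v y ≤ √(1 + (μ + deriv φ y) ^ 2) := by
      rw [le_sqrt_one_add_sq_iff_slope_le_abs hv0]
      obtain ⟨n, hn, -⟩ := existsUnique_sub_zsmul_mem_Ico (zero_lt_one' ℝ) y a
      simp only [zsmul_eq_mul, mul_one] at hn
      have hform : ∀ x : ℝ, x - n ∈ Icc a (a + 1) → physicalSolution v μ a z x + μ * x =
          min (∫ t in a..(x - n), slope v t)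
            (2 * (∫ t in a..z, slope v t) - ∫ t in a..(x - n), slope v t) + n * μ := by
        intro x hx
        rw [← physicalSolution_add_mul_eq_min hv hz hbal hx, ← physicalSolution_add_mul,
          sub_add_cancel]
      have hSn : ∀ x, (∫ t in a..x, slope v t) =
          (∫ t in a..(x - n), slope v t) + n * ∫ y in a..(a + 1), slope v y := by
        intro x
        rw [← integral_slope_add_int hv hper, sub_add_cancel]
      have hm := integral_slope_mono hv a
      rcases eq_or_lt_of_le hn.1 with h | h
      · have h2 : slope v y = 0 := by
          rw [slope_eq_zero_iff hv0, ← ha, h]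
          have := hper.sub_int_mul_eq (x := y) n
          rw [mul_one] at this
          exact this.symm
        rw [h2]
        exact abs_nonneg _
      rcases le_total (y - n) z with hyz | hyz
      · have := nonpos_of_eventually_le_left ((hS y).sub (hdφ φ hφ y)) (by
          filter_upwards [hloc.filter_mono nhdsWithin_le_nhds, self_mem_nhdsWithin,
            Ioo_mem_nhdsLT (show a + n < y by linarith)] with x hx hxy hxa
          have hxy : x < y := hxy
          have e1 := hform x ⟨by linarith [hxa.1], by linarith [hn.2]⟩
          have e2 := hform y ⟨hn.1, hn.2.le⟩
          have l1 : (∫ t in a..(x - n), slope v t) ≤ ∫ t in a..z, slope v t := hm (by linarith)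
          have l2 : (∫ t in a..(y - n), slope v t) ≤ ∫ t in a..z, slope v t := hm hyz
          rw [min_eq_left (by linarith)] at e1 e2
          have s1 := hSn x
          have s2 := hSn y
          simp only [Pi.sub_apply]
          linarith)
        linarith [le_abs_self (μ + deriv φ y)]
      · have := nonneg_of_eventually_le_right ((hdφ φ hφ y).add (hS y)).neg (by
          filter_upwards [hloc.filter_mono nhdsWithin_le_nhds, self_mem_nhdsWithin,
            Ioo_mem_nhdsGT (show y < a + 1 + n by linarith [hn.2])] with x hx hxy hxa
          have hxy : y < x := hxy
          have e1 := hform x ⟨by linarith [hn.1], by linarith [hxa.2]⟩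
          have e2 := hform y ⟨hn.1, hn.2.le⟩
          have l1 : (∫ t in a..z, slope v t) ≤ ∫ t in a..(x - n), slope v t := hm (by linarith)
          have l2 : (∫ t in a..z, slope v t) ≤ ∫ t in a..(y - n), slope v t := hm hyz
          rw [min_eq_right (by linarith)] at e1 e2
          have s1 := hSn x
          have s2 := hSn y
          simp only [Pi.add_apply, Pi.neg_apply]
          linarith)
        linarith [neg_le_abs (μ + deriv φ y)]
    linarith

/-- The balance point exists and is unique. -/
lemma exists_isBalanced (hv : Continuous v) (hper : Function.Periodic v 1) (hv0 : ∀ x, v x ≤ 0)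
    (hμ : |μ| < ∫ y in (0:ℝ)..1, slope v y)
    (hfin : {x ∈ Icc a (a + 1) | v x = 0}.Finite) :
    ∃ z ∈ Ioo a (a + 1), IsBalanced v μ a z ∧
      ∀ z' ∈ Ioo a (a + 1), IsBalanced v μ a z' → z' = z := by
  have hsc := continuous_slope hv
  have hS1 := (periodic_slope hper).intervalIntegral_add_eq a 0
  rw [zero_add] at hS1
  -- The slope vanishes only at finitely many points, hence on no interval. Strictness gives
  -- uniqueness of the balance point.
  have hmono : StrictMonoOn (fun x => ∫ t in a..x, slope v t) (Icc a (a + 1)) := by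
    intro x hx y hy hxy
    have e1 := intervalIntegral.integral_add_adjacent_intervals
      (hsc.intervalIntegrable (μ := MeasureTheory.volume) a x) (hsc.intervalIntegrable x y)
    have h1 : 0 < ∫ t in x..y, slope v t := by
      refine intervalIntegral.integral_pos hxy hsc.continuousOn (fun t _ => slope_nonneg t) ?_
      by_contra! h
      refine Icc_infinite hxy (hfin.subset fun t ht => ⟨⟨hx.1.trans ht.1, ht.2.trans hy.2⟩, ?_⟩)
      exact (slope_eq_zero_iff hv0).1 (le_antisymm (h t ht) (slope_nonneg t))
    simp only
    linarith
  have hμ' := abs_lt.1 hμ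
  obtain ⟨z, hz, hzS⟩ := intermediate_value_Ioo (by linarith : a ≤ a + 1)
    (continuous_integral_slope (v := v) (a := a) hv).continuousOn
    (show (μ + ∫ y in a..(a + 1), slope v y) / 2 ∈ _ from
      ⟨by rw [intervalIntegral.integral_same, hS1]; linarith, by rw [hS1]; linarith⟩)
  simp only at hzS
  refine ⟨z, hz, isBalanced_of_two_mul hv (by rw [hzS]; ring), fun z' hz' hb => ?_⟩
  refine hmono.injOn (Ioo_subset_Icc_self hz') (Ioo_subset_Icc_self hz) ?_
  have := hb.two_mul hv
  linarith

end

/-! ### Selection of the flattest maximum and convergence of `w_d`. -/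

section
variable {v : ℝ → ℝ} {μ : ℝ}

lemma mem_maxPoints_iff (hmax : IsGreatest (range v) 0) {x : ℝ} :
    x ∈ maxPoints v ↔ x ∈ Ico (0:ℝ) 1 ∧ v x = 0 := by
  have hv0 : ∀ x, v x ≤ 0 := fun x => hmax.2 ⟨x, rfl⟩
  obtain ⟨x₀, hx₀⟩ := hmax.1
  refine and_congr_right fun _ => ⟨fun h => le_antisymm (hv0 x) (hx₀ ▸ h x₀), fun h y => ?_⟩
  rw [h]
  exact hv0 y

lemma maxPoints_nonempty (hper : Function.Periodic v 1) (hmax : IsGreatest (range v) 0) :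
    (maxPoints v).Nonempty := by
  obtain ⟨x₀, hx₀⟩ := hmax.1
  obtain ⟨x, hx, h⟩ := hper.exists_mem_Ico₀ one_pos x₀
  exact ⟨x, (mem_maxPoints_iff hmax).2 ⟨hx, by rw [← h, hx₀]⟩⟩

/-- A maximum point in a shifted cell is a translate of one in `[0, 1)`. -/
lemma mem_maxPoints_or_sub_one_mem (hper : Function.Periodic v 1) (hmax : IsGreatest (range v) 0)
    {a x : ℝ} (ha : a ∈ Ico (0:ℝ) 1) (hx : x ∈ Icc a (a + 1)) (hvx : v x = 0) :
    x ∈ maxPoints v ∨ x - 1 ∈ maxPoints v := by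
  rw [mem_maxPoints_iff hmax, mem_maxPoints_iff hmax]
  rcases lt_or_ge x 1 with h | h
  · exact Or.inl ⟨⟨ha.1.trans hx.1, h⟩, hvx⟩
  · exact Or.inr ⟨⟨by linarith, by linarith [hx.2, ha.2]⟩, by rw [hper.sub_eq, hvx]⟩

lemma finite_zeros_cell (hper : Function.Periodic v 1) (hmax : IsGreatest (range v) 0)
    (hfin : (maxPoints v).Finite) {a : ℝ} (ha : a ∈ Ico (0:ℝ) 1) :
    {x ∈ Icc a (a + 1) | v x = 0}.Finite := by
  refine (hfin.union (hfin.image (· + 1))).subset fun x hx => ?_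
  rcases mem_maxPoints_or_sub_one_mem hper hmax ha hx.1 hx.2 with h | h
  · exact Or.inl h
  · exact Or.inr ⟨x - 1, h, by ring⟩

/-- Since `v'' ≤ 0` at maxima, distinct values have distinct moduli. The minimal modulus may be
zero, so the flattest maximum may be degenerate. -/
lemma exists_flattest_maxPoint (hv : ContDiff ℝ 2 v) (hper : Function.Periodic v 1)
    (hmax : IsGreatest (range v) 0) (hfin : (maxPoints v).Finite)
    (hdistinct : InjOn (deriv (deriv v)) (maxPoints v)) :
    ∃ a ∈ maxPoints v, ∀ y ∈ maxPoints v, y ≠ a → |deriv (deriv v) a| < |deriv (deriv v) y| := by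
  have hv0 : ∀ x, v x ≤ 0 := fun x => hmax.2 ⟨x, rfl⟩
  obtain ⟨a, ha, hmin⟩ := hfin.exists_minimalFor (fun x => |deriv (deriv v) x|) _
    (maxPoints_nonempty hper hmax)
  refine ⟨a, ha, fun y hy hne => lt_of_not_ge fun hle => hne ?_⟩
  have hle' := hmin hy hle
  have h1 := second_deriv_nonpos_of_max hv hv0 ((mem_maxPoints_iff hmax).1 ha).2
  have h2 := second_deriv_nonpos_of_max hv hv0 ((mem_maxPoints_iff hmax).1 hy).2
  simp only [abs_of_nonpos h1, abs_of_nonpos h2] at hle hle'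
  exact hdistinct hy ha (by linarith)

theorem tendstoUniformly_physicalSolution (hv : ContDiff ℝ 2 v) (hper : Function.Periodic v 1)
    (hv0 : ∀ x, v x ≤ 0) (hμ : |μ| < ∫ y in (0:ℝ)..1, slope v y) {a z : ℝ} (ha : v a = 0)
    (hfin : {x ∈ Icc a (a + 1) | v x = 0}.Finite)
    (hmin : ∀ e ∈ Ioo a (a + 1), v e = 0 → √|deriv (deriv v) a| < √|deriv (deriv v) e|)
    (hz : z ∈ Icc a (a + 1)) (hbal : IsBalanced v μ a z) {H : ℝ → ℝ} {w : ℝ → ℝ → ℝ}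
    (hw : ∀ d : ℝ, 0 < d → IsCellSolution v μ d (H d) (w d)) :
    TendstoUniformly w (fun x => physicalSolution v μ a z x - physicalSolution v μ a z 0)
      (𝓝[>] (0 : ℝ)) := by
  have hvc := hv.continuous
  rw [Metric.tendstoUniformly_iff]
  intro ε hε
  filter_upwards [self_mem_nhdsWithin, eventually_abs_integral_sub_le hv hper hv0 hμ ha hfin hmin
    (show 0 < ε / 3 by positivity)] with d hd hest
  have hd : 0 < d := hd
  have hwd := hw d hd
  have hest := hest _ _ (hwd.isProfile hd)
  have hcell : ∀ x ∈ Icc a (a + 1), |(w d x - physicalSolution v μ a z x) -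
      (w d a - physicalSolution v μ a z a)| ≤ ε / 3 := by
    intro x hx
    have h1 : ∫ y in a..x, (μ + deriv (w d) y) = μ * (x - a) + (w d x - w d a) := by
      rw [intervalIntegral.integral_add (by simp) (hwd.continuous_deriv.intervalIntegrable _ _),
        intervalIntegral.integral_deriv_eq_sub' _ rfl
          (fun x _ => (hwd.hasDerivAt x).differentiableAt) hwd.continuous_deriv.continuousOn]
      simp
      ring
    have h2 := hest x hx
    have h3 := physicalSolution_add_mul_eq_min hvc hz hbal hx
    have h4 := physicalSolution_add_mul_eq_min hvc hz hbal (left_mem_Icc.2 (by linarith) :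
      a ∈ Icc a (a + 1))
    have h5 : (∫ y in a..a, slope v y) ≤ ∫ y in a..z, slope v y := integral_slope_mono hvc a hz.1
    rw [intervalIntegral.integral_same] at h4 h5
    rw [min_eq_left (by linarith)] at h4
    rw [h1, ← hbal.two_mul hvc, ← h3] at h2
    convert h2 using 2
    linarith
  have hall : ∀ x, |(w d x - physicalSolution v μ a z x) -
      (w d a - physicalSolution v μ a z a)| ≤ ε / 3 := by
    intro x
    have hp : Function.Periodic (fun x => w d x - physicalSolution v μ a z x) 1 := fun x => by
      simp only [hwd.periodic x, periodic_physicalSolution x]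
    obtain ⟨y, hy, hxy⟩ := hp.exists_mem_Ico one_pos x a
    have := hcell y (Ico_subset_Icc_self hy)
    rwa [hxy]
  intro x
  -- The cell estimate is normalized at `a`, the claim at `0`; the change costs a second `ε / 3`.
  have h1 := hall x
  have h2 := hall 0
  rw [hwd.normalized] at h2
  rw [Real.dist_eq, abs_lt]
  have h1 := abs_le.1 h1
  have h2 := abs_le.1 h2
  constructor <;> linarith

end

end GEquation

open GEquation in
theorem theorem1p2 (v : ℝ → ℝ) (μ : ℝ)
    (hv : ContDiff ℝ (⊤ : ℕ∞) v) (hper : Function.Periodic v 1)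
    (hmax : IsGreatest (Set.range v) 0)
    (hμ : |μ| < ∫ y in (0 : ℝ)..1, √((1 - v y) ^ 2 - 1))
    (hfin : (maxPoints v).Finite)
    (hdistinct : Set.InjOn (deriv (deriv v)) (maxPoints v)) :
    (∀ d : ℝ, 0 < d → ∃! Hw : ℝ × (ℝ → ℝ), IsCellSolution v μ d Hw.1 Hw.2) ∧
    ∃ xbar ∈ maxPoints v,
      (∀ y ∈ maxPoints v, y ≠ xbar → |deriv (deriv v) xbar| < |deriv (deriv v) y|) ∧
      ∃ xμ ∈ Set.Ioo xbar (xbar + 1),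
        IsBalanced v μ xbar xμ ∧
        (∀ z ∈ Set.Ioo xbar (xbar + 1), IsBalanced v μ xbar z → z = xμ) ∧
        (∀ x ∈ Set.Icc xbar (xbar + 1),
          physicalSolution v μ xbar xμ x = cellProfile v μ xbar xμ x) ∧
        IsInviscidViscositySolution v μ 1 (physicalSolution v μ xbar xμ) ∧
        ∀ (H : ℝ → ℝ) (w : ℝ → ℝ → ℝ),
          (∀ d : ℝ, 0 < d → IsCellSolution v μ d (H d) (w d)) →
          TendstoUniformly w
            (fun x => physicalSolution v μ xbar xμ x - physicalSolution v μ xbar xμ 0)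
            (𝓝[>] (0 : ℝ)) := by
  have hv2 : ContDiff ℝ 2 v := contDiff_infty.1 hv 2
  have hvc := hv2.continuous
  have hv0 : ∀ x, v x ≤ 0 := fun x => hmax.2 ⟨x, rfl⟩
  have hμ' : |μ| < ∫ y in (0 : ℝ)..1, GEquation.slope v y := hμ
  obtain ⟨a, ha, hmin⟩ := exists_flattest_maxPoint hv2 hper hmax hfin hdistinct
  obtain ⟨haI, hva⟩ := (mem_maxPoints_iff hmax).1 ha
  have hzeros := finite_zeros_cell hper hmax hfin haI
  obtain ⟨z, hz, hbal, huniq⟩ := exists_isBalanced hvc hper hv0 hμ' hzeros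
  have hz' := Ioo_subset_Icc_self hz
  refine ⟨fun d hd => existsUnique_isCellSolution hvc hper μ hd, a, ha, hmin, z, hz, hbal, huniq,
    fun x hx => physicalSolution_eq_cellProfile hvc hz' hbal hx,
    isInviscidViscositySolution_physicalSolution hvc hper hv0 hva hz' hbal,
    fun H w hw => tendstoUniformly_physicalSolution hv2 hper hv0 hμ' hva hzeros ?_ hz' hbal hw⟩
  intro e he hve
  refine Real.sqrt_lt_sqrt (abs_nonneg _) ?_
  rcases mem_maxPoints_or_sub_one_mem hper hmax haI (Ioo_subset_Icc_self he) hve with h | h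
  · exact hmin e h he.1.ne'
  · have h1 : deriv (deriv v) e = deriv (deriv v) (e - 1) := by
      have hp : deriv v = fun x => deriv v (x - 1) := by
        ext x
        rw [← deriv_comp_sub_const, funext hper.sub_eq]
      conv_lhs => rw [hp]
      rw [deriv_comp_sub_const]
    rw [h1]
    exact hmin (e - 1) h (show e - 1 < a by linarith [he.2]).ne
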